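/- Let $S^1=\mathbb R/\mathbb Z$, let $\mathrm{Homeo}_+(S^1)$ and $\mathrm{Homeo}_+(I)$ be the groups of orientation-preserving homeomorphisms of the circle and of the interval $I=[0,1]$, and let $\mathrm{rot}:\mathrm{Homeo}_+(S^1)\to\mathbb R/\mathbb Z$ be Poincaré's rotation number, $\mathrm{rot}(f)=\lim_{n\to\infty}F^n(t)/n \pmod 1$ for any lift $F:\mathbb R\to\mathbb R$ of $f$ and any $t\in\mathbb R$. For groups $C$ and $T$ write $C\wr T=\left(\prod_{t\in T}C\right)\rtimes T$ and $C\wr_r T=\left(\bigoplus_{t\in T}C\right)\rtimes T$ for the unrestricted and the restricted standard wreath product. Theorem. Let $G\le \mathrm{Homeo}_+(S^1)$ be a subgroup with no non-abelian free subgroup. Then either $G$ is abelian, or there are subgroups $H_0$ and $Q$ of $\mathrm{Homeo}_+(S^1)$ and an embedding $j:G\hookrightarrow H_0\wr Q$ such that the following hold. 1. (a) $\mathrm{rot}(h)=0$ for all $h\in H_0$. (b) There are an at most countable index set $\mathfrak N$ and an embedding of groups $H_0\hookrightarrow\prod_{\mathfrak N}\mathrm{Homeo}_+(I)$. (c) $H_0$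 has no non-abelian free subgroup. 2. The restriction of $\mathrm{rot}$ to $G$ is a homomorphism, with kernel $\ker(\mathrm{rot})\cap G=\{g\in G:\mathrm{rot}(g)=0\}$, and $j$ followed by the projection $H_0\wr Q\to Q$ induces an isomorphism $G/(\ker(\mathrm{rot})\cap G)\cong Q$. Moreover $Q$ is isomorphic to an at most countable subgroup of $\mathbb R/\mathbb Z$. 3. The subgroup $\langle H_0,Q\rangle$ of $\mathrm{Homeo}_+(S^1)$ is isomorphic to $H_0\wr_r Q$, by an isomorphism $b: H_0\wr_r Q\to\langle H_0,Q\rangle$ that restricts to the identity on $H_0$ (the factor of the base group indexed by $1\in Q$) and on $Q$. It extends to an injective homomorphism $\Phi:H_0\wr Q\to\mathrm{Homeo}_+(S^1)$ of the unrestricted wreath product whose image contains $G$; more precisely $\Phi(j(g))=g$ for all $g\in G$. -/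

import Mathlib

open Filter Topology

/-! ### Orientation preserving homeomorphisms of the circle and of the interval

The circle is `UnitAddCircle`, that is, `ℝ / ℤ`.  An invertible element of Mathlib's monoid
`CircleDeg1Lift` is an increasing bijection (hence a homeomorphism) `F : ℝ → ℝ` with
`F (x + 1) = F x + 1`. -/

/-- `F` is a lift of the circle homeomorphism `f` through the projection `ℝ → ℝ / ℤ`. -/
def IsCircleLift (F : CircleDeg1Liftˣ) (f : UnitAddCircle ≃ₜ UnitAddCircle) : Prop :=
  ∀ x : ℝ, ((F x : ℝ) : UnitAddCircle) = f (x : UnitAddCircle)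

/-- `Homeo₊(S¹)`: the homeomorphisms of the circle that have an increasing lift to the line. -/
def HomeoPlusCircle : Subgroup (UnitAddCircle ≃ₜ UnitAddCircle) where
  carrier := {f | ∃ F : CircleDeg1Liftˣ, IsCircleLift F f}
  one_mem' := ⟨1, fun _ => rfl⟩
  mul_mem' := by
    rintro f g ⟨F, hF⟩ ⟨K, hK⟩
    refine ⟨F * K, fun x => ?_⟩
    have h := hF (K x)
    rw [hK x] at h
    exact h
  inv_mem' := by
    rintro f ⟨F, hF⟩
    refine ⟨F⁻¹, fun x => ?_⟩
    have h := hF ((F⁻¹ : CircleDeg1Liftˣ) x)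
    rw [CircleDeg1Lift.units_apply_inv_apply] at h
    exact ((Homeomorph.symm_apply_eq f).2 h).symm

/-- `Homeo₊(I)`: the increasing homeomorphisms of the unit interval `I = [0, 1]`. -/
def HomeoPlusInterval : Subgroup (unitInterval ≃ₜ unitInterval) where
  carrier := {f | StrictMono f}
  one_mem' := fun _ _ h => h
  mul_mem' := fun hf hg _ _ h => hf (hg h)
  inv_mem' := by
    intro f hf x y h
    have hf' : StrictMono f := hf
    refine hf'.lt_iff_lt.1 ?_
    have hx : f (f⁻¹ x) = x := f.apply_symm_apply x
    have hy : f (f⁻¹ y) = y := f.apply_symm_apply y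
    rw [hx, hy]
    exact h

/-! ### The rotation number -/

/-- Poincaré's rotation number in `ℝ / ℤ`: the class modulo `1` of the translation number
`lim Fⁿ(t) / n` of a lift `F`. -/
noncomputable def rotationNumber (f : HomeoPlusCircle) : UnitAddCircle :=
  ((CircleDeg1Lift.translationNumber (f.2.choose : CircleDeg1Liftˣ) : ℝ) : UnitAddCircle)

/-- Two lifts of the same homeomorphism differ by an integer translation. -/
theorem IsCircleLift.exists_int {f : UnitAddCircle ≃ₜ UnitAddCircle} {F K : CircleDeg1Liftˣ}
    (hF : IsCircleLift F f) (hK : IsCircleLift K f) : ∃ m : ℤ, ∀ x : ℝ, F x = K x + m := by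
  have hcF : Continuous (fun x : ℝ => F x) := (CircleDeg1Lift.toOrderIso F).continuous
  have hcK : Continuous (fun x : ℝ => K x) := (CircleDeg1Lift.toOrderIso K).continuous
  have hint : ∀ x : ℝ, ∃ m : ℤ, F x - K x = m := by
    intro x
    have h : ((F x - K x : ℝ) : UnitAddCircle) = 0 := by
      rw [AddCircle.coe_sub, hF x, hK x, sub_self]
    obtain ⟨m, hm⟩ := (AddCircle.coe_eq_zero_iff (1 : ℝ)).1 h
    exact ⟨m, by rw [← hm]; simp⟩
  choose k hk using hint
  have hkc : Continuous k := by
    refine Int.isClosedEmbedding_coe_real.isEmbedding.continuous_iff.2 ?_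
    have he : ((fun m : ℤ => (m : ℝ)) ∘ k) = fun x => F x - K x := by
      funext x
      exact (hk x).symm
    rw [he]
    exact hcF.sub hcK
  refine ⟨k 0, fun x => ?_⟩
  have h0 : k x = k 0 := PreconnectedSpace.constant inferInstance hkc
  have h1 := hk x
  rw [h0] at h1
  linarith

/-- The rotation number can be computed from any lift and any starting point. -/
theorem rotationNumber_eq_of_lift (f : HomeoPlusCircle) (F : CircleDeg1Liftˣ)
    (hF : IsCircleLift F f.1) (t : ℝ) :
    ∃ r : ℝ, Tendsto (fun n : ℕ => (fun x : ℝ => F x)^[n] t / n) atTop (𝓝 r) ∧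
      rotationNumber f = (r : UnitAddCircle) := by
  refine ⟨CircleDeg1Lift.translationNumber F, ?_, ?_⟩
  · have h := (CircleDeg1Lift.tendsto_translationNumber (F : CircleDeg1Lift) t).add
      (tendsto_const_div_atTop_nhds_zero_nat t)
    rw [add_zero] at h
    refine h.congr fun n => ?_
    rw [CircleDeg1Lift.coe_pow]
    ring
  · obtain ⟨m, hm⟩ := f.2.choose_spec.exists_int hF
    have hmul : (f.2.choose : CircleDeg1Liftˣ) =
        CircleDeg1Lift.translate (Multiplicative.ofAdd (m : ℝ)) * F := by
      refine Units.ext (CircleDeg1Lift.ext fun x => ?_)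
      rw [hm x]
      exact add_comm _ _
    have hcomm : Commute
        ((CircleDeg1Lift.translate (Multiplicative.ofAdd (m : ℝ)) : CircleDeg1Liftˣ) :
          CircleDeg1Lift) (F : CircleDeg1Lift) := by
      refine CircleDeg1Lift.ext fun x => ?_
      change (m : ℝ) + F x = F ((m : ℝ) + x)
      exact (CircleDeg1Lift.map_int_add (F : CircleDeg1Lift) m x).symm
    unfold rotationNumber
    rw [hmul, Units.val_mul, CircleDeg1Lift.translationNumber_mul_of_commute hcomm,
      CircleDeg1Lift.translationNumber_translate, AddCircle.coe_add]
    have hz : ((m : ℝ) : UnitAddCircle) = 0 :=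
      (AddCircle.coe_eq_zero_iff (1 : ℝ)).2 ⟨m, by simp⟩
    rw [hz, zero_add]

/-! ### Free subgroups and wreath products -/

/-- Every free subgroup of `Γ` is abelian. -/
def NoNonabelianFreeSubgroup (Γ : Type*) [Group Γ] : Prop :=
  ∀ K : Subgroup Γ, IsFreeGroup K → ∀ x y : K, x * y = y * x

/-- The inclusion of `C` in the unrestricted standard wreath product `C ≀ᵣ T` as the factor, of
the base group `∏ t : T, C`, that is indexed by `1`. -/
noncomputable def wreathBase (C T : Type*) [Group C] [Group T] : C →* C ≀ᵣ T where
  toFun c := by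
    classical
    exact ⟨Pi.mulSingle 1 c, 1⟩
  map_one' := by
    ext <;> simp
  map_mul' a b := by
    ext t
    · by_cases ht : t = 1
      · subst ht
        simp
      · simp [ht]
    · simp

/-- The restricted standard wreath product `(⨁ t : T, C) ⋊ T`, as the subgroup of the unrestricted
one `C ≀ᵣ T = (∏ t : T, C) ⋊ T` of the elements whose base component has finite support. -/
def restrictedWreath (C T : Type*) [Group C] [Group T] : Subgroup (C ≀ᵣ T) where
  carrier := {w | (Function.mulSupport w.left).Finite}
  one_mem' := by simp
  mul_mem' := by
    intro a b ha hb
    have hb' : (Function.mulSupport fun t => b.left (a.right⁻¹ * t)).Finite :=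
      Set.Finite.preimage ((mul_right_injective a.right⁻¹).injOn) hb
    exact (Set.Finite.union ha hb').subset (Function.mulSupport_mul _ _)
  inv_mem' := by
    intro a ha
    have h : (Function.mulSupport fun t => a.left (a.right * t)).Finite :=
      Set.Finite.preimage ((mul_right_injective a.right).injOn) ha
    refine h.subset fun t ht => ?_
    simpa [Function.mem_mulSupport] using ht

theorem wreathBase_mem_restrictedWreath (C T : Type*) [Group C] [Group T] (c : C) :
    wreathBase C T c ∈ restrictedWreath C T := by
  classical
  refine (Set.finite_singleton (1 : T)).subset fun t ht => ?_
  by_contra hne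
  refine ht ?_
  change (Pi.mulSingle (1 : T) c : T → C) t = 1
  exact Pi.mulSingle_eq_of_ne (M := fun _ => C) hne c

theorem inl_mem_restrictedWreath (C T : Type*) [Group C] [Group T] (t : T) :
    RegularWreathProduct.inl t ∈ restrictedWreath C T := by
  change (Function.mulSupport (1 : T → C)).Finite
  simp

/-! A circle homeomorphism has rotation number zero exactly when it has a fixed point. If two such
elements of `G` had disjoint fixed sets, high powers of them would play ping-pong and generate a
free group; so any two share a fixed point (`exists_common_fixed`). For finitely many elements,
suppose `S` has a common fixed point but shares none with `g`. Then the group generated by `S`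
contains an `h` moving Fix(g) off itself (`exists_displacing`), and `g` and its conjugate by `h`
have disjoint fixed sets, a contradiction. Compactness yields a nonempty closed `G`-invariant set
`X`, `commonFixedSet G`, fixed pointwise by every element of `G` that has a fixed point.

Lifts of two elements of `G` are comparable on all of the preimage of `X`, which makes the
translation number additive on lifts and rot a homomorphism on `G`, with kernel `N`. If `N` is
trivial, `G` embeds in ℝ/ℤ. Otherwise `X` is not the whole circle, and `G ⧸ N` is countable because
it acts freely on the left endpoints of the gaps of `X`.

For the wreath product, cut the circle into half-open pieces along `X`. Freeness gives an
equivariant map from the circle to `G ⧸ N`, constant on pieces, and elements of `N` can be glued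
along its fibres because they fix `X`. `H₀` is `N` acting on the fibre over 1 only; `Q` is `G ⧸ N`
permuting the fibres through coset representatives, an honest action even if the extension does not
split. The Kaloujnine–Krasner embedding of `G` then takes place inside Homeo₊(S¹). -/

/-! ### The action on the circle, and lifts to the line -/

noncomputable instance : MulAction HomeoPlusCircle UnitAddCircle where
  smul f x := f.1 x
  one_smul _ := rfl
  mul_smul _ _ _ := rfl

theorem HomeoPlusCircle.ext_smul {f g : HomeoPlusCircle}
    (h : ∀ x : UnitAddCircle, f • x = g • x) : f = g :=
  Subtype.ext (Homeomorph.ext h)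

instance : ContinuousConstSMul HomeoPlusCircle UnitAddCircle where
  continuous_const_smul f := f.1.continuous

theorem UnitAddCircle.coe_eq_coe_iff {x y : ℝ} :
    (x : UnitAddCircle) = y ↔ ∃ m : ℤ, x = y + m := by
  rw [← sub_eq_zero, ← AddCircle.coe_sub, AddCircle.coe_eq_zero_iff]
  constructor
  · rintro ⟨m, hm⟩
    exact ⟨m, by simp at hm; linarith⟩
  · rintro ⟨m, hm⟩
    exact ⟨m, by simp; linarith⟩

theorem UnitAddCircle.coe_add_int (x : ℝ) (m : ℤ) : ((x + m : ℝ) : UnitAddCircle) = x :=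
  UnitAddCircle.coe_eq_coe_iff.2 ⟨m, rfl⟩

namespace CircleDeg1Lift

theorem continuous_units (F : CircleDeg1Liftˣ) : Continuous (fun x : ℝ => F x) :=
  (toOrderIso F).continuous

theorem strictMono_units (F : CircleDeg1Liftˣ) : StrictMono (fun x : ℝ => F x) :=
  (toOrderIso F).strictMono

/-- The map of the circle induced by a lift. -/
noncomputable def toCircleMap (F : CircleDeg1Lift) : UnitAddCircle → UnitAddCircle :=
  Quotient.lift (fun x : ℝ => ((F x : ℝ) : UnitAddCircle)) (by
    intro x y h
    have h' : (x : UnitAddCircle) = y := Quotient.sound h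
    obtain ⟨m, rfl⟩ := UnitAddCircle.coe_eq_coe_iff.1 h'
    rw [F.map_add_int, UnitAddCircle.coe_add_int])

theorem toCircleMap_coe (F : CircleDeg1Lift) (x : ℝ) :
    F.toCircleMap (x : UnitAddCircle) = ((F x : ℝ) : UnitAddCircle) := rfl

theorem continuous_toCircleMap (F : CircleDeg1Liftˣ) :
    Continuous (F : CircleDeg1Lift).toCircleMap := by
  refine (QuotientAddGroup.isQuotientMap_mk _).continuous_iff.2 ?_
  exact (AddCircle.continuous_mk' (1 : ℝ)).comp (continuous_units F)

/-- The orientation preserving circle homeomorphism with a given lift. -/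
noncomputable def toHomeoPlusCircle (F : CircleDeg1Liftˣ) : HomeoPlusCircle :=
  ⟨{ toFun := (F : CircleDeg1Lift).toCircleMap
     invFun := ((F⁻¹ : CircleDeg1Liftˣ) : CircleDeg1Lift).toCircleMap
     left_inv := by
       intro x
       induction x using QuotientAddGroup.induction_on with
       | H x => erw [toCircleMap_coe, units_inv_apply_apply]
     right_inv := by
       intro x
       induction x using QuotientAddGroup.induction_on with
       | H x => erw [toCircleMap_coe, units_apply_inv_apply]
     continuous_toFun := continuous_toCircleMap F
     continuous_invFun := continuous_toCircleMap F⁻¹ }, F, fun _ => rfl⟩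

theorem toHomeoPlusCircle_smul (F : CircleDeg1Liftˣ) (x : ℝ) :
    toHomeoPlusCircle F • (x : UnitAddCircle) = ((F x : ℝ) : UnitAddCircle) := rfl

end CircleDeg1Lift

open CircleDeg1Lift

theorem IsCircleLift.coe_apply {F : CircleDeg1Liftˣ} {f : HomeoPlusCircle}
    (hF : IsCircleLift F f.1) (x : ℝ) : ((F x : ℝ) : UnitAddCircle) = f • (x : UnitAddCircle) :=
  hF x

theorem IsCircleLift.mul {F K : CircleDeg1Liftˣ} {f g : HomeoPlusCircle}
    (hF : IsCircleLift F f.1) (hK : IsCircleLift K g.1) : IsCircleLift (F * K) (f * g).1 := by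
  intro x
  have h := hF (K x)
  rw [hK x] at h
  exact h

theorem IsCircleLift.inv {F : CircleDeg1Liftˣ} {f : HomeoPlusCircle}
    (hF : IsCircleLift F f.1) : IsCircleLift F⁻¹ (f⁻¹).1 := by
  intro x
  have h := hF ((F⁻¹ : CircleDeg1Liftˣ) x)
  rw [units_apply_inv_apply] at h
  exact ((Homeomorph.symm_apply_eq f.1).2 h).symm

theorem IsCircleLift.eq_of_apply_eq {F K : CircleDeg1Liftˣ} {f : HomeoPlusCircle}
    (hF : IsCircleLift F f.1) (hK : IsCircleLift K f.1) {x : ℝ} (h : F x = K x) : F = K := by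
  obtain ⟨m, hm⟩ := hF.exists_int hK
  have h0 : (m : ℝ) = 0 := by linarith [hm x]
  exact Units.ext (CircleDeg1Lift.ext fun y => by rw [hm y, h0, add_zero])

theorem HomeoPlusCircle.exists_lift_apply_eq (f : HomeoPlusCircle) {x y : ℝ}
    (h : f • (x : UnitAddCircle) = y) : ∃ F : CircleDeg1Liftˣ, IsCircleLift F f.1 ∧ F x = y := by
  obtain ⟨F, hF⟩ := f.2
  obtain ⟨m, hm⟩ := UnitAddCircle.coe_eq_coe_iff.1 ((hF x).trans h)
  refine ⟨translate (Multiplicative.ofAdd (-(m : ℝ))) * F, fun z => ?_, ?_⟩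
  · rw [← hF z]
    refine UnitAddCircle.coe_eq_coe_iff.2 ⟨-m, ?_⟩
    change -(m : ℝ) + F z = _
    push_cast
    ring
  · change -(m : ℝ) + F x = _
    rw [hm]
    ring

/-- The lift at `p` of the homeomorphisms fixing `p`. -/
noncomputable def liftAt (p : ℝ) :
    MulAction.stabilizer HomeoPlusCircle (p : UnitAddCircle) →* CircleDeg1Liftˣ :=
  MonoidHom.mk' (fun f => (HomeoPlusCircle.exists_lift_apply_eq f.1 f.2).choose) (by
    intro f g
    have hf := (HomeoPlusCircle.exists_lift_apply_eq f.1 f.2).choose_spec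
    have hg := (HomeoPlusCircle.exists_lift_apply_eq g.1 g.2).choose_spec
    have hfg := (HomeoPlusCircle.exists_lift_apply_eq (f * g).1 (f * g).2).choose_spec
    refine hfg.1.eq_of_apply_eq (hf.1.mul hg.1) (x := p) ?_
    rw [hfg.2]
    exact ((congrArg _ hg.2).trans hf.2).symm)

section liftAt

variable {p : ℝ} (f : MulAction.stabilizer HomeoPlusCircle (p : UnitAddCircle))

theorem isCircleLift_liftAt : IsCircleLift (liftAt p f) f.1.1 :=
  (HomeoPlusCircle.exists_lift_apply_eq f.1 f.2).choose_spec.1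

theorem liftAt_apply_self : liftAt p f p = p :=
  (HomeoPlusCircle.exists_lift_apply_eq f.1 f.2).choose_spec.2

/-- The lift fixing `p` fixes every `p + k`, so it preserves the unit intervals between them; the
integer by which it moves `z` is therefore less than 1 in absolute value. -/
theorem liftAt_apply_of_fixed {z : ℝ} (hz : f.1 • (z : UnitAddCircle) = z) :
    liftAt p f z = z := by
  obtain ⟨m, hm⟩ := UnitAddCircle.coe_eq_coe_iff.1 ((isCircleLift_liftAt f z).trans hz)
  have hp := liftAt_apply_self f
  set F := liftAt p f
  set k : ℤ := ⌊z - p⌋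
  have h1 : (k : ℝ) ≤ z - p := Int.floor_le _
  have h2 : z - p < k + 1 := Int.lt_floor_add_one _
  have h3 : F (p + k) = p + k := by rw [map_add_int, hp]
  have h4 : F (p + k + 1) = p + k + 1 := by rw [map_add_one, h3]
  have h5 : F (p + k) ≤ F z := (strictMono_units F).monotone (by linarith)
  have h6 : F z < F (p + k + 1) := strictMono_units F (by linarith)
  have h7 : (m : ℝ) < 1 := by linarith
  have h8 : (-1 : ℝ) < m := by linarith
  have : m = 0 := by
    have h7' : m < 1 := by exact_mod_cast h7
    have h8' : -1 < m := by exact_mod_cast h8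
    omega
  rw [hm, this]
  simp

end liftAt

/-! ### Rotation number zero and fixed points -/

theorem rotationNumber_eq_translationNumber {f : HomeoPlusCircle} {F : CircleDeg1Liftˣ}
    (hF : IsCircleLift F f.1) :
    rotationNumber f = ((translationNumber (F : CircleDeg1Lift) : ℝ) : UnitAddCircle) := by
  obtain ⟨r, hr, h⟩ := rotationNumber_eq_of_lift f F hF 0
  have h2 := tendsto_translation_number₀ (F : CircleDeg1Lift)
  simp only [coe_pow] at h2
  rw [h, tendsto_nhds_unique hr h2]

theorem rotationNumber_eq_zero_iff {f : HomeoPlusCircle} :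
    rotationNumber f = 0 ↔ ∃ x : UnitAddCircle, f • x = x := by
  constructor
  · intro h
    obtain ⟨F, hF⟩ := f.2
    rw [rotationNumber_eq_translationNumber hF, ← AddCircle.coe_zero,
      UnitAddCircle.coe_eq_coe_iff] at h
    obtain ⟨m, hm⟩ := h
    rw [zero_add] at hm
    obtain ⟨x, hx⟩ := (translationNumber_eq_int_iff _ (continuous_units F)).1 hm
    exact ⟨x, by rw [← hF.coe_apply, hx, UnitAddCircle.coe_add_int]⟩
  · rintro ⟨x, hx⟩
    induction x using QuotientAddGroup.induction_on with
    | H x =>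
      obtain ⟨F, hF, hFx⟩ := HomeoPlusCircle.exists_lift_apply_eq f hx
      rw [rotationNumber_eq_translationNumber hF,
        translationNumber_of_eq_add_int (m := 0) (x := x) _ (by simpa using hFx)]
      simp

/-! ### Dynamics near the fixed points and the ping-pong lemma -/

/-- The orbit of `y` increases, bounded by `z`, to a fixed point `q`. Once an iterate enters a left
neighbourhood of `q` inside `W` it stays there, and entering by time `N` is an open condition on the
starting point. The order is general so that the order dual covers points that move down. -/
theorem StrictMono.eventually_iterate_mem_of_lt_map {α : Type*} [ConditionallyCompleteLinearOrder α]
    [TopologicalSpace α] [OrderTopology α] {φ : α → α} (hφ : StrictMono φ)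
    (hc : Continuous φ) {W : Set α} (hW : IsOpen W) (hfix : ∀ x, φ x = x → x ∈ W) {y z : α}
    (hyz : y ≤ z) (hz : φ z = z) (hy : y < φ y) :
    ∃ N : ℕ, ∀ᶠ x in 𝓝 y, ∀ n ≥ N, φ^[n] x ∈ W := by
  have hmono : ∀ x, x < φ x → Monotone fun n => φ^[n] x := fun x hx =>
    hφ.monotone.monotone_iterate_of_le_map hx.le
  have hsucc : ∀ n, φ^[n] y < φ^[n + 1] y := fun n => by
    rw [Function.iterate_succ_apply]
    exact hφ.iterate n hy
  have hbdd : BddAbove (Set.range fun n => φ^[n] y) := by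
    refine ⟨z, ?_⟩
    rintro _ ⟨n, rfl⟩
    calc φ^[n] y ≤ φ^[n] z := hφ.monotone.iterate n hyz
      _ = z := Function.iterate_fixed hz n
  set q := ⨆ n, φ^[n] y
  have hlim : Tendsto (fun n => φ^[n] y) atTop (𝓝 q) := tendsto_atTop_ciSup (hmono y hy) hbdd
  have hqfix : φ q = q := isFixedPt_of_tendsto_iterate hlim hc.continuousAt
  have hlt : ∀ n, φ^[n] y < q := fun n => (hsucc n).trans_le (le_ciSup hbdd (n + 1))
  obtain ⟨l, hl, hlW⟩ :=
    exists_Ioc_subset_of_mem_nhds (hW.mem_nhds (hfix q hqfix)) ⟨y, hlt 0⟩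
  obtain ⟨N, hN⟩ := (hlim.eventually (lt_mem_nhds hl)).exists
  refine ⟨N, ?_⟩
  have hcN : Continuous φ^[N] := hc.iterate N
  filter_upwards [(isOpen_lt continuous_id hc).mem_nhds hy,
    (isOpen_lt continuous_const hcN).mem_nhds hN,
    (isOpen_lt hcN continuous_const).mem_nhds (hlt N)] with x hx hx1 hx2 n hn
  refine hlW ⟨hx1.trans_le (hmono x hx hn), ?_⟩
  obtain ⟨k, rfl⟩ := Nat.exists_eq_add_of_le' hn
  rw [Function.iterate_add_apply]
  calc φ^[k] (φ^[N] x) ≤ φ^[k] q := hφ.monotone.iterate k (le_of_lt hx2)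
    _ = q := Function.iterate_fixed hqfix k

theorem IsCircleLift.pow_smul_coe {F : CircleDeg1Liftˣ} {f : HomeoPlusCircle}
    (hF : IsCircleLift F f.1) (n : ℕ) (x : ℝ) :
    f ^ n • (x : UnitAddCircle) = (((fun y : ℝ => F y)^[n] x : ℝ) : UnitAddCircle) := by
  induction n with
  | zero => simp
  | succ n ih =>
    rw [pow_succ', mul_smul, ih, Function.iterate_succ_apply', hF.coe_apply]

namespace HomeoPlusCircle

theorem exists_forall_pow_smul_mem {f : HomeoPlusCircle} {U : Set UnitAddCircle} (hU : IsOpen U)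
    (hfix : ∀ x : UnitAddCircle, f • x = x → x ∈ U) (hne : ∃ x : UnitAddCircle, f • x = x) :
    ∃ N : ℕ, ∀ n ≥ N, ∀ x ∉ U, f ^ n • x ∈ U := by
  obtain ⟨p, hp⟩ := hne
  induction p using QuotientAddGroup.induction_on with
  | H p =>
  obtain ⟨F, hF, hFp⟩ := exists_lift_apply_eq f hp
  set φ : ℝ → ℝ := fun x => F x
  have hφ : StrictMono φ := strictMono_units F
  have hc : Continuous φ := continuous_units F
  set W : Set ℝ := (fun x : ℝ => (x : UnitAddCircle)) ⁻¹' U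
  have hW : IsOpen W := hU.preimage (AddCircle.continuous_mk' (1 : ℝ))
  have hWfix : ∀ x, φ x = x → x ∈ W := fun x hx => hfix _ (by
    rw [← hF.coe_apply]
    exact congrArg _ hx)
  have hp1 : φ (p + 1) = p + 1 := by
    change F (p + 1) = _
    rw [map_add_one, hFp]
  have hK : IsCompact (Set.Icc p (p + 1) \ W) := isCompact_Icc.diff hW
  -- Compactness of a fundamental interval minus `W` turns the local bounds into a uniform one.
  have key : ∃ N : ℕ, ∀ x ∈ Set.Icc p (p + 1) \ W, ∀ n ≥ N, φ^[n] x ∈ W := by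
    refine hK.induction_on (p := fun S => ∃ N : ℕ, ∀ x ∈ S, ∀ n ≥ N, φ^[n] x ∈ W)
      ⟨0, by simp⟩ ?_ ?_ ?_
    · rintro s t hst ⟨N, hN⟩
      exact ⟨N, fun x hx => hN x (hst hx)⟩
    · rintro s t ⟨N, hN⟩ ⟨M, hM⟩
      refine ⟨max N M, ?_⟩
      rintro x (hx | hx) n hn
      · exact hN x hx n (le_trans (le_max_left _ _) hn)
      · exact hM x hx n (le_trans (le_max_right _ _) hn)
    · intro y hy
      have : ∃ N : ℕ, ∀ᶠ x in 𝓝 y, ∀ n ≥ N, φ^[n] x ∈ W := by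
        rcases lt_trichotomy y (φ y) with h | h | h
        · exact hφ.eventually_iterate_mem_of_lt_map hc hW hWfix hy.1.2 hp1 h
        · exact absurd (hWfix y h.symm) hy.2
        · exact StrictMono.eventually_iterate_mem_of_lt_map (α := ℝᵒᵈ) (φ := φ) (W := W)
            (y := y) (z := p) (fun a b hab => hφ hab) hc hW hWfix hy.1.1 hFp h
      obtain ⟨N, hN⟩ := this
      exact ⟨_, mem_nhdsWithin_of_mem_nhds hN, N, fun x hx => hx⟩
  obtain ⟨N, hN⟩ := key
  refine ⟨N, fun n hn x hx => ?_⟩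
  obtain ⟨y, hy, rfl⟩ : ∃ y ∈ Set.Ico p (p + 1), (y : UnitAddCircle) = x :=
    ⟨_, (AddCircle.equivIco 1 p x).2, AddCircle.coe_equivIco⟩
  rw [hF.pow_smul_coe]
  exact hN y ⟨Set.Ico_subset_Icc_self hy, hx⟩ n hn

theorem exists_forall_zpow_smul_mem {f : HomeoPlusCircle} {U : Set UnitAddCircle} (hU : IsOpen U)
    (hfix : ∀ x : UnitAddCircle, f • x = x → x ∈ U) (hne : ∃ x : UnitAddCircle, f • x = x) :
    ∃ N : ℕ, ∀ n : ℤ, N ≤ n.natAbs → ∀ x ∉ U, f ^ n • x ∈ U := by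
  obtain ⟨N, hN⟩ := exists_forall_pow_smul_mem hU hfix hne
  obtain ⟨M, hM⟩ := exists_forall_pow_smul_mem (f := f⁻¹) hU
    (fun x hx => hfix x (inv_smul_eq_iff.1 hx).symm)
    (hne.imp fun x hx => inv_smul_eq_iff.2 hx.symm)
  refine ⟨max N M, fun n hn x hx => ?_⟩
  obtain ⟨k, rfl | rfl⟩ := n.eq_nat_or_neg
  · rw [zpow_natCast]
    exact hN k (by simpa using le_trans (le_max_left _ _) hn) x hx
  · rw [zpow_neg, zpow_natCast, ← inv_pow]
    exact hM k (by simpa using le_trans (le_max_right _ _) hn) x hx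

end HomeoPlusCircle

theorem FreeGroup.of_true_mul_of_false_ne :
    (FreeGroup.of true * FreeGroup.of false : FreeGroup Bool) ≠
      FreeGroup.of false * FreeGroup.of true := by
  decide

theorem NoNonabelianFreeSubgroup.not_injective {Γ : Type*} [Group Γ]
    (hΓ : NoNonabelianFreeSubgroup Γ) (φ : FreeGroup Bool →* Γ) : ¬ Function.Injective φ := by
  intro hφ
  have e : FreeGroup Bool ≃* φ.range := MonoidHom.ofInjective hφ
  have h := hΓ φ.range (IsFreeGroup.ofMulEquiv e) (e (.of true)) (e (.of false))
  rw [← map_mul, ← map_mul] at h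
  exact FreeGroup.of_true_mul_of_false_ne (e.injective h)

open scoped Pointwise in
/-- Ping-pong for elements all of whose nonzero powers play. -/
theorem FreeGroup.injective_lift_of_zpow_ping_pong {ι Γ α : Type*} [Nontrivial ι] [Group Γ]
    [MulAction Γ α] (a : ι → Γ) (X : ι → Set α) (hX : ∀ i, (X i).Nonempty)
    (hdisj : Pairwise (Function.onFun Disjoint X))
    (hpp : Pairwise fun i j => ∀ n : ℤ, n ≠ 0 → ∀ x ∈ X j, a i ^ n • x ∈ X i) :
    Function.Injective (FreeGroup.lift a) := by
  have : FreeGroup.lift a =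
      (Monoid.CoprodI.lift fun i => FreeGroup.lift fun _ => a i).comp
        (@freeGroupEquivCoprodI ι).toMonoidHom := by
    ext i
    simp
  rw [this, MonoidHom.coe_comp]
  refine Function.Injective.comp ?_ (MulEquiv.injective freeGroupEquivCoprodI)
  refine Monoid.CoprodI.lift_injective_of_ping_pong
    (fun i => FreeGroup.lift fun _ : Unit => a i) (Or.inr ?_) X hX hdisj ?_
  -- With possibly only two players, ping-pong needs a factor with at least three elements; these
  -- factors are infinite cyclic.
  · obtain ⟨i⟩ : Nonempty ι := inferInstance
    exact ⟨i, le_trans (Cardinal.natCast_le_aleph0 (n := 3)) (Cardinal.aleph0_le_mk _)⟩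
  · intro i j hij
    refine FreeGroup.freeGroupUnitEquivInt.forall_congr_left.mpr fun n hne => ?_
    have hn : n ≠ 0 := by
      rintro rfl
      apply hne
      simp [FreeGroup.freeGroupUnitEquivInt]
    change FreeGroup.lift (fun _ => a i) (FreeGroup.of () ^ n) • X j ⊆ X i
    simp only [map_zpow, FreeGroup.lift_apply_of]
    rintro _ ⟨x, hx, rfl⟩
    exact hpp hij n hn x hx

/-- Disjoint closed fixed sets have disjoint open neighbourhoods `U` and `V`. Nonzero powers of `f ^
L` send the complement of `U` into `U`, those of `g ^ L` the complement of `V` into `V`: a ping-pong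
table. -/
theorem NoNonabelianFreeSubgroup.exists_common_fixed {G : Subgroup HomeoPlusCircle}
    (hG : NoNonabelianFreeSubgroup G) {f g : HomeoPlusCircle} (hf : f ∈ G) (hg : g ∈ G)
    (hf' : ∃ x : UnitAddCircle, f • x = x) (hg' : ∃ x : UnitAddCircle, g • x = x) :
    ∃ x : UnitAddCircle, f • x = x ∧ g • x = x := by
  by_contra! hcon
  have hclosed : ∀ k : HomeoPlusCircle, IsClosed {x : UnitAddCircle | k • x = x} := fun k =>
    isClosed_eq (continuous_const_smul k) continuous_id
  obtain ⟨U, V, hU, hV, hfU, hgV, hUV⟩ := normal_separation (hclosed f) (hclosed g)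
    (Set.disjoint_left.2 fun x hx hx' => hcon x hx hx')
  obtain ⟨N, hN⟩ := HomeoPlusCircle.exists_forall_zpow_smul_mem hU (fun x hx => hfU hx) hf'
  obtain ⟨M, hM⟩ := HomeoPlusCircle.exists_forall_zpow_smul_mem hV (fun x hx => hgV hx) hg'
  set L : ℕ := N + M + 1
  have hL : ∀ n : ℤ, n ≠ 0 → L ≤ ((L : ℤ) * n).natAbs := by
    intro n hn
    rw [Int.natAbs_mul, Int.natAbs_natCast]
    exact Nat.le_mul_of_pos_right _ (Int.natAbs_pos.2 hn)
  let a : Bool → G := fun i => bif i then ⟨f, hf⟩ ^ L else ⟨g, hg⟩ ^ L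
  refine hG.not_injective (FreeGroup.lift a)
    (FreeGroup.injective_lift_of_zpow_ping_pong (α := UnitAddCircle) a
      (fun i => bif i then U else V) ?_ ?_ ?_)
  · rintro (_ | _)
    · exact hg'.imp fun x hx => hgV hx
    · exact hf'.imp fun x hx => hfU hx
  · rintro (_ | _) (_ | _) hij
    · exact absurd rfl hij
    · exact hUV.symm
    · exact hUV
    · exact absurd rfl hij
  · rintro (_ | _) (_ | _) hij n hn x hx
    · exact absurd rfl hij
    · have h := hM (L * n) (by have := hL n hn; omega) x (Set.disjoint_left.1 hUV hx)
      rw [zpow_mul, zpow_natCast] at h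
      exact h
    · have h := hN (L * n) (by have := hL n hn; omega) x (Set.disjoint_right.1 hUV hx)
      rw [zpow_mul, zpow_natCast] at h
      exact h
    · exact absurd rfl hij

/-! ### Displacing compact sets and common fixed points -/

section Displacement

variable {H : Subgroup (ℝ ≃o ℝ)}

/-- Otherwise the supremum of the orbit of `c` lies in `[c, d]` and is fixed by all of `H`. -/
theorem exists_lt_apply_of_no_fixed {c d : ℝ}
    (hZ : ∀ z ∈ Set.Icc c d, ∃ h ∈ H, h z ≠ z) : ∃ h ∈ H, d < h c := by
  by_contra! hcon
  have hbdd : BddAbove (Set.range fun h : H => h.1 c) :=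
    ⟨d, by rintro _ ⟨h, rfl⟩; exact hcon _ h.2⟩
  set s := ⨆ h : H, h.1 c
  have hle : ∀ h ∈ H, h s ≤ s := by
    intro h hh
    refine h.le_symm_apply.1 (ciSup_le fun k => ?_)
    have h1 : (h * k.1) c ≤ s := le_ciSup hbdd (⟨h, hh⟩ * k)
    exact h.le_symm_apply.2 h1
  have hcs : c ≤ s := le_ciSup hbdd (1 : H)
  have hsd : s ≤ d := ciSup_le fun h => hcon _ h.2
  obtain ⟨h, hh, hne⟩ := hZ s ⟨hcs, hsd⟩
  refine hne (le_antisymm (hle h hh) ?_)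
  have h2 : h⁻¹ s ≤ s := hle _ (H.inv_mem hh)
  calc s = h (h⁻¹ s) := (h.apply_symm_apply s).symm
    _ ≤ h s := h.monotone h2

/-- Let `k` push the first interval to the right of itself, and replace every other `I` by the hull
of `I ∪ k I`. If `e` displaces the hulls, then `e * k` displaces each such `I`, since `k I` and `I`
lie in the same hull. -/
theorem exists_forall_displaced (l : List (ℝ × ℝ)) (hl : ∀ I ∈ l, I.1 ≤ I.2)
    (hZ : ∀ I ∈ l, ∀ z ∈ Set.Icc I.1 I.2, ∃ h ∈ H, h z ≠ z) :
    ∃ h ∈ H, ∀ I ∈ l, I.2 < h I.1 ∨ h I.2 < I.1 := by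
  induction hn : l.length generalizing l with
  | zero =>
    rw [List.length_eq_zero_iff] at hn
    subst hn
    exact ⟨1, H.one_mem, by simp⟩
  | succ n ih =>
    match l, hn with
    | I₀ :: l, hn =>
    obtain ⟨k, hk, hkI⟩ := exists_lt_apply_of_no_fixed (hZ I₀ (by simp))
    set hull : ℝ × ℝ → ℝ × ℝ := fun I => (min I.1 (k I.1), max I.2 (k I.2))
    obtain ⟨h, hh, hdis⟩ := ih (l.map hull) (by
        intro J hJ
        obtain ⟨I, hI, rfl⟩ := List.mem_map.1 hJ
        exact (min_le_left _ _).trans ((hl I (by simp [hI])).trans (le_max_left _ _))) (by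
        intro J hJ
        obtain ⟨I, hI, rfl⟩ := List.mem_map.1 hJ
        rintro z ⟨hz1, hz2⟩
        -- A global fixed point outside `I` lies on the same side of `I` and of `k I`, hence outside
        -- their hull.
        by_contra! hfix
        have hkz := hfix k hk
        rcases lt_or_ge z I.1 with h1 | h1
        · have := k.strictMono h1
          rw [hkz] at this
          exact absurd hz1 (not_le.2 (lt_min h1 this))
        rcases lt_or_ge I.2 z with h2 | h2
        · have := k.strictMono h2
          rw [hkz] at this
          exact absurd hz2 (not_le.2 (max_lt h2 this))
        obtain ⟨g, hg, hgz⟩ := hZ I (by simp [hI]) z ⟨h1, h2⟩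
        exact hgz (hfix g hg)) (by simpa using hn)
    -- Displacement is symmetric under inversion, so `e` can be chosen among `h`, `h⁻¹` not to undo
    -- the push of `I₀` to the right.
    obtain ⟨e, he, heI, hdis'⟩ : ∃ e ∈ H, k I₀.1 ≤ e (k I₀.1) ∧
        ∀ I ∈ l, (hull I).2 < e (hull I).1 ∨ e (hull I).2 < (hull I).1 := by
      rcases le_total (k I₀.1) (h (k I₀.1)) with h1 | h1
      · exact ⟨h, hh, h1, fun I hI => hdis _ (List.mem_map_of_mem hI)⟩
      · refine ⟨h⁻¹, H.inv_mem hh, h.le_symm_apply.2 h1, fun I hI => ?_⟩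
        rcases hdis _ (List.mem_map_of_mem hI) with h2 | h2
        · exact Or.inr (h.symm_apply_lt.2 h2)
        · exact Or.inl (h.lt_symm_apply.2 h2)
    refine ⟨e * k, H.mul_mem he hk, fun I hI => ?_⟩
    rcases List.mem_cons.1 hI with rfl | hI
    · exact Or.inl (hkI.trans_le heI)
    · rcases hdis' I hI with h1 | h1
      · exact Or.inl ((le_max_left _ _).trans_lt (h1.trans_le (e.monotone (min_le_right _ _))))
      · exact Or.inr ((e.monotone (le_max_right _ _)).trans_lt (h1.trans_le (min_le_left _ _)))

/-- Cover `K` by finitely many intervals free of global fixed points. Displacing each is not enough,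
as a point could land in another one; so the hulls of pairs are displaced too, whenever they are
free of global fixed points. -/
theorem exists_displacing_of_isCompact {K : Set ℝ} (hK : IsCompact K)
    (hKZ : ∀ z ∈ K, ∃ h ∈ H, h z ≠ z) : ∃ h ∈ H, ∀ x ∈ K, h x ∉ K := by
  have hZ : IsOpen {z : ℝ | ∃ h ∈ H, h z ≠ z} := by
    have : {z : ℝ | ∃ h ∈ H, h z ≠ z} = ⋃ h ∈ H, {z | h z ≠ z} := by
      ext
      simp
    rw [this]
    exact isOpen_biUnion fun h _ => isOpen_ne_fun h.continuous continuous_id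
  obtain ⟨t, ht, hKt⟩ : ∃ t : Finset (ℝ × ℝ),
      (∀ I ∈ t, I.1 ≤ I.2 ∧ ∀ z ∈ Set.Icc I.1 I.2, ∃ h ∈ H, h z ≠ z) ∧
      ∀ x ∈ K, ∃ I ∈ t, x ∈ Set.Icc I.1 I.2 := by
    classical
    refine hK.induction_on (p := fun S => ∃ t : Finset (ℝ × ℝ),
      (∀ I ∈ t, I.1 ≤ I.2 ∧ ∀ z ∈ Set.Icc I.1 I.2, ∃ h ∈ H, h z ≠ z) ∧
      ∀ x ∈ S, ∃ I ∈ t, x ∈ Set.Icc I.1 I.2) ⟨∅, by simp, by simp⟩ ?_ ?_ ?_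
    · rintro S T hST ⟨t, ht, hT⟩
      exact ⟨t, ht, fun x hx => hT x (hST hx)⟩
    · rintro S T ⟨s, hs, hS⟩ ⟨t, ht, hT⟩
      refine ⟨s ∪ t, fun I hI => (Finset.mem_union.1 hI).elim (hs I) (ht I), ?_⟩
      rintro x (hx | hx)
      · obtain ⟨I, hI, h⟩ := hS x hx
        exact ⟨I, Finset.mem_union_left _ hI, h⟩
      · obtain ⟨I, hI, h⟩ := hT x hx
        exact ⟨I, Finset.mem_union_right _ hI, h⟩
    · intro x hx
      obtain ⟨ε, hε, hball⟩ := Metric.nhds_basis_closedBall.mem_iff.1 (hZ.mem_nhds (hKZ x hx))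
      refine ⟨Metric.closedBall x ε,
        mem_nhdsWithin_of_mem_nhds (Metric.closedBall_mem_nhds x hε), {(x - ε, x + ε)}, ?_, ?_⟩
      · rintro I hI
        rw [Finset.mem_singleton] at hI
        subst hI
        refine ⟨by simp only; linarith, fun z hz => hball ?_⟩
        rwa [Real.closedBall_eq_Icc]
      · intro y hy
        rw [Real.closedBall_eq_Icc] at hy
        exact ⟨_, Finset.mem_singleton_self _, hy⟩
  classical
  set hull : (ℝ × ℝ) × (ℝ × ℝ) → ℝ × ℝ :=
    fun P => (min P.1.1 P.2.1, max P.1.2 P.2.2)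
  set s : Finset (ℝ × ℝ) := ((t ×ˢ t).image hull).filter
    (fun I => ∀ z ∈ Set.Icc I.1 I.2, ∃ h ∈ H, h z ≠ z) with hsdef
  obtain ⟨h, hh, hdis⟩ := exists_forall_displaced (H := H) s.toList (by
      intro I hI
      rw [Finset.mem_toList, hsdef, Finset.mem_filter, Finset.mem_image] at hI
      obtain ⟨⟨P, hP, rfl⟩, -⟩ := hI
      exact (min_le_left _ _).trans
        ((ht P.1 (Finset.mem_product.1 hP).1).1.trans (le_max_left _ _))) (by
      intro I hI
      rw [Finset.mem_toList, hsdef, Finset.mem_filter] at hI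
      exact hI.2)
  refine ⟨h, hh, fun x hx hy => ?_⟩
  obtain ⟨I, hI, hxI⟩ := hKt x hx
  obtain ⟨J, hJ, hyJ⟩ := hKt _ hy
  -- No global fixed point separates `x` from `h x`, so none lies in the hull of the intervals
  -- containing them. That hull is then displaced, yet contains both points.
  have hmem : hull (I, J) ∈ s := by
    rw [hsdef, Finset.mem_filter]
    refine ⟨Finset.mem_image_of_mem _ (Finset.mk_mem_product hI hJ), ?_⟩
    rintro z ⟨hz1, hz2⟩
    by_contra! hfix
    have hzI : ¬ z ∈ Set.Icc I.1 I.2 := fun hz => by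
      obtain ⟨g, hg, hgz⟩ := (ht I hI).2 z hz
      exact hgz (hfix g hg)
    have hzJ : ¬ z ∈ Set.Icc J.1 J.2 := fun hz => by
      obtain ⟨g, hg, hgz⟩ := (ht J hJ).2 z hz
      exact hgz (hfix g hg)
    have hhz := hfix h hh
    rcases lt_trichotomy x z with h1 | h1 | h1
    · have h2 := h.strictMono h1
      rw [hhz] at h2
      have h3 : I.2 < z := not_le.1 fun h4 => hzI ⟨hxI.1.trans h1.le, h4⟩
      have h4 : J.2 < z := not_le.1 fun h5 => hzJ ⟨hyJ.1.trans h2.le, h5⟩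
      exact absurd hz2 (not_le.2 (max_lt h3 h4))
    · exact hzI (h1 ▸ hxI)
    · have h2 := h.strictMono h1
      rw [hhz] at h2
      have h3 : z < I.1 := not_le.1 fun h4 => hzI ⟨h4, h1.le.trans hxI.2⟩
      have h4 : z < J.1 := not_le.1 fun h5 => hzJ ⟨h5, h2.le.trans hyJ.2⟩
      exact absurd hz1 (not_le.2 (lt_min h3 h4))
  rcases hdis _ (Finset.mem_toList.2 hmem) with h1 | h1
  · have h2 : h (hull (I, J)).1 ≤ h x := h.monotone ((min_le_left _ _).trans hxI.1)
    have h3 : h x ≤ (hull (I, J)).2 := hyJ.2.trans (le_max_right _ _)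
    linarith
  · have h2 : h x ≤ h (hull (I, J)).2 := h.monotone (hxI.2.trans (le_max_left _ _))
    have h3 : (hull (I, J)).1 ≤ h x := (min_le_right _ _).trans hyJ.1
    linarith

end Displacement

/-- A group of circle homeomorphisms with a common fixed point displaces every compact set that
contains none of its common fixed points. -/
theorem HomeoPlusCircle.exists_displacing {H : Subgroup HomeoPlusCircle} {p : UnitAddCircle}
    (hp : ∀ h ∈ H, h • p = p) {K : Set UnitAddCircle} (hK : IsClosed K)
    (hKH : ∀ x ∈ K, ∃ h ∈ H, h • x ≠ x) : ∃ h ∈ H, ∀ x ∈ K, h • x ∉ K := by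
  induction p using QuotientAddGroup.induction_on with
  | H p =>
  set S : Subgroup (MulAction.stabilizer HomeoPlusCircle (p : UnitAddCircle)) :=
    H.subgroupOf _
  set L : Subgroup (ℝ ≃o ℝ) := S.map (toOrderIso.comp (liftAt p))
  set K' : Set ℝ := Set.Icc p (p + 1) ∩ (fun x : ℝ => (x : UnitAddCircle)) ⁻¹' K
  obtain ⟨k, hk, hdis⟩ := exists_displacing_of_isCompact (H := L) (K := K')
    (isCompact_Icc.inter_right (hK.preimage (AddCircle.continuous_mk' (1 : ℝ)))) (by
      rintro z ⟨-, hz⟩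
      obtain ⟨h, hh, hne⟩ := hKH _ hz
      refine ⟨_, Subgroup.mem_map_of_mem _ (show (⟨h, hp h hh⟩ :
        MulAction.stabilizer HomeoPlusCircle (p : UnitAddCircle)) ∈ S from hh), fun heq => hne ?_⟩
      rw [← (isCircleLift_liftAt ⟨h, hp h hh⟩).coe_apply]
      exact congrArg _ heq)
  obtain ⟨f, hf, rfl⟩ := hk
  refine ⟨f.1, hf, fun x hx hfx => ?_⟩
  obtain ⟨y, hy, rfl⟩ : ∃ y ∈ Set.Ico p (p + 1), (y : UnitAddCircle) = x :=
    ⟨_, (AddCircle.equivIco 1 p x).2, AddCircle.coe_equivIco⟩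
  have hmono := (strictMono_units (liftAt p f)).monotone
  refine hdis y ⟨Set.Ico_subset_Icc_self hy, hx⟩ ⟨⟨?_, ?_⟩, ?_⟩
  · have := hmono hy.1
    simp only [liftAt_apply_self] at this
    exact this
  · have := hmono hy.2.le
    simp only [map_add_one, liftAt_apply_self] at this
    exact this
  · rw [← (isCircleLift_liftAt f).coe_apply] at hfx
    exact hfx

namespace NoNonabelianFreeSubgroup

variable {G : Subgroup HomeoPlusCircle}

/-- In the inductive step, an `h` displacing Fix(g) would make the fixed sets of `h * g * h⁻¹` and
`g` disjoint, against `exists_common_fixed`. -/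
theorem exists_common_fixed_finset (hG : NoNonabelianFreeSubgroup G)
    (S : Finset HomeoPlusCircle) (hS : ∀ f ∈ S, f ∈ G ∧ ∃ x : UnitAddCircle, f • x = x) :
    ∃ x : UnitAddCircle, ∀ f ∈ S, f • x = x := by
  classical
  induction S using Finset.induction_on with
  | empty => exact ⟨0, by simp⟩
  | insert g S _ ih =>
    obtain ⟨p, hp⟩ := ih fun f hf => hS f (Finset.mem_insert_of_mem hf)
    obtain ⟨hg, y, hy⟩ := hS g (Finset.mem_insert_self _ _)
    by_contra! hcon
    have hHG : Subgroup.closure (S : Set HomeoPlusCircle) ≤ G :=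
      (Subgroup.closure_le _).2 fun f hf => (hS f (Finset.mem_insert_of_mem hf)).1
    have hHp : Subgroup.closure (S : Set HomeoPlusCircle) ≤
        MulAction.stabilizer HomeoPlusCircle p := (Subgroup.closure_le _).2 fun f hf => hp f hf
    obtain ⟨h, hh, hdis⟩ := HomeoPlusCircle.exists_displacing (K := {x | g • x = x})
      (fun h hh => hHp hh) (isClosed_eq (continuous_const_smul g) continuous_id) (by
        intro x hx
        obtain ⟨f, hf, hne⟩ := hcon x
        rcases Finset.mem_insert.1 hf with rfl | hf
        · exact absurd hx hne
        · exact ⟨f, Subgroup.subset_closure hf, hne⟩)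
    obtain ⟨x, hx, hx'⟩ := hG.exists_common_fixed
      (G.mul_mem (G.mul_mem (hHG hh) hg) (G.inv_mem (hHG hh))) hg
      ⟨h • y, by simp [mul_smul, hy]⟩ ⟨y, hy⟩
    have h1 : g • (h⁻¹ • x) = h⁻¹ • x := by
      rw [eq_inv_smul_iff, ← mul_smul, ← mul_smul]
      exact hx
    exact hdis _ h1 (by simpa using hx')

theorem exists_global_fixed (hG : NoNonabelianFreeSubgroup G) :
    ∃ p : UnitAddCircle, ∀ f ∈ G, (∃ x : UnitAddCircle, f • x = x) → f • p = p := by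
  set ι := {f : HomeoPlusCircle // f ∈ G ∧ ∃ x : UnitAddCircle, f • x = x}
  have h := CompactSpace.iInter_nonempty (X := UnitAddCircle)
    (fun f : ι => isClosed_eq (continuous_const_smul f.1) continuous_id) (by
      intro u
      classical
      obtain ⟨x, hx⟩ := hG.exists_common_fixed_finset (u.image Subtype.val) (by
        intro f hf
        obtain ⟨i, -, rfl⟩ := Finset.mem_image.1 hf
        exact i.2)
      exact ⟨x, Set.mem_iInter₂.2 fun i hi => hx _ (Finset.mem_image_of_mem _ hi)⟩)
  obtain ⟨p, hp⟩ := h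
  exact ⟨p, fun f hf hfx => Set.mem_iInter.1 hp ⟨f, hf, hfx⟩⟩

end NoNonabelianFreeSubgroup

/-! ### The rotation number is a homomorphism -/

/-- The points fixed by all the elements of `G` that have a fixed point. -/
def commonFixedSet (G : Subgroup HomeoPlusCircle) : Set UnitAddCircle :=
  {x | ∀ f ∈ G, (∃ y : UnitAddCircle, f • y = y) → f • x = x}

section commonFixedSet

variable {G : Subgroup HomeoPlusCircle}

theorem isClosed_commonFixedSet : IsClosed (commonFixedSet G) := by
  have : commonFixedSet G = ⋂ f ∈ G, ⋂ (_ : ∃ y : UnitAddCircle, f • y = y),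
      {x | f • x = x} := by
    ext
    simp [commonFixedSet]
  rw [this]
  exact isClosed_biInter fun f _ => isClosed_iInter fun _ =>
    isClosed_eq (continuous_const_smul f) continuous_id

theorem smul_mem_commonFixedSet {g : HomeoPlusCircle} (hg : g ∈ G) {x : UnitAddCircle}
    (hx : x ∈ commonFixedSet G) : g • x ∈ commonFixedSet G := by
  rintro f hf ⟨y, hy⟩
  have h := hx (g⁻¹ * f * g) (G.mul_mem (G.mul_mem (G.inv_mem hg) hf) hg)
    ⟨g⁻¹ • y, by simp [mul_smul, hy]⟩
  rwa [mul_smul, mul_smul, inv_smul_eq_iff] at h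

/-- If both inequalities failed, `K⁻¹ * F` would move one point up and another down, so by the
intermediate value theorem it would have a fixed point. Then it would fix the whole preimage of
`commonFixedSet G`. -/
theorem IsCircleLift.le_or_le_on_commonFixedSet {F K : CircleDeg1Liftˣ} {f k : HomeoPlusCircle}
    (hF : IsCircleLift F f.1) (hK : IsCircleLift K k.1) (hf : f ∈ G) (hk : k ∈ G) :
    (∀ x : ℝ, (x : UnitAddCircle) ∈ commonFixedSet G → F x ≤ K x) ∨
      ∀ x : ℝ, (x : UnitAddCircle) ∈ commonFixedSet G → K x ≤ F x := by
  by_contra! hcon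
  obtain ⟨⟨x, hx, hKF⟩, y, hy, hFK⟩ := hcon
  have hE : IsCircleLift (K⁻¹ * F) (k⁻¹ * f).1 := hK.inv.mul hF
  have hmem : k⁻¹ * f ∈ G := G.mul_mem (G.inv_mem hk) hf
  have h1 : x < (K⁻¹ * F : CircleDeg1Liftˣ) x := by
    have := strictMono_units K⁻¹ hKF
    simp only [units_inv_apply_apply] at this
    exact this
  have h2 : (K⁻¹ * F : CircleDeg1Liftˣ) y < y := by
    have := strictMono_units K⁻¹ hFK
    simp only [units_inv_apply_apply] at this
    exact this
  obtain ⟨w, hw⟩ := mem_range_of_exists_le_of_exists_ge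
    (f := fun z => (K⁻¹ * F : CircleDeg1Liftˣ) z - z) (c := 0)
    ((continuous_units _).sub continuous_id) ⟨y, sub_nonpos.2 h2.le⟩
    ⟨x, sub_nonneg.2 h1.le⟩
  have hw' : (K⁻¹ * F : CircleDeg1Liftˣ) w = w := sub_eq_zero.1 hw
  have hfixw : (k⁻¹ * f) • (w : UnitAddCircle) = w := by
    rw [← hE.coe_apply, hw']
  have heq : K⁻¹ * F = liftAt w ⟨k⁻¹ * f, hfixw⟩ :=
    hE.eq_of_apply_eq (isCircleLift_liftAt ⟨k⁻¹ * f, hfixw⟩) (x := w)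
      (by rw [hw', liftAt_apply_self])
  have h3 := liftAt_apply_of_fixed ⟨k⁻¹ * f, hfixw⟩ (hx _ hmem ⟨_, hfixw⟩)
  rw [← heq] at h3
  exact h1.ne' h3

/-- Moving every `F` inside past the `K`s only increases the value on `S`, so (FK)ⁿx ≤ KⁿFⁿx, which
is at most Fⁿx + Kⁿ0 + 1. Divide by `n`. -/
theorem CircleDeg1Lift.translationNumber_mul_le_of_forall_le {F K : CircleDeg1Lift} {S : Set ℝ}
    (hS : S.Nonempty) (hFS : ∀ x ∈ S, F x ∈ S) (hKS : ∀ x ∈ S, K x ∈ S)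
    (h : ∀ x ∈ S, F (K x) ≤ K (F x)) :
    translationNumber (F * K) ≤ translationNumber F + translationNumber K := by
  have hFn : ∀ n : ℕ, ∀ x ∈ S, F^[n] x ∈ S := by
    intro n
    induction n with
    | zero => exact fun x hx => hx
    | succ n ih => exact fun x hx => ih _ (hFS x hx)
  have h1 : ∀ n : ℕ, ∀ x ∈ S, F^[n] (K x) ≤ K (F^[n] x) := by
    intro n
    induction n with
    | zero => exact fun x _ => le_rfl
    | succ n ih =>
      intro x hx
      rw [Function.iterate_succ_apply', Function.iterate_succ_apply']
      exact (F.monotone (ih x hx)).trans (h _ (hFn n x hx))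
  have h2 : ∀ n : ℕ, ∀ x ∈ S, (F * K)^[n] x ≤ K^[n] (F^[n] x) := by
    intro n
    induction n with
    | zero => exact fun x _ => le_rfl
    | succ n ih =>
      intro x hx
      rw [Function.iterate_succ_apply]
      refine (ih _ (hFS _ (hKS x hx))).trans ?_
      rw [Function.iterate_succ_apply]
      refine (K.monotone.iterate n) ?_
      rw [← Function.iterate_succ_apply (f := F)]
      exact h1 (n + 1) x hx
  obtain ⟨x, hx⟩ := hS
  have hlim : ∀ (E : CircleDeg1Lift) (y : ℝ),
      Tendsto (fun n : ℕ => E^[n] y / n) atTop (𝓝 (translationNumber E)) := by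
    intro E y
    have h := (E.tendsto_translationNumber y).add (tendsto_const_div_atTop_nhds_zero_nat y)
    rw [add_zero] at h
    refine h.congr fun n => ?_
    rw [coe_pow]
    ring
  have hlim2 := ((hlim F x).add (hlim K 0)).add (tendsto_const_div_atTop_nhds_zero_nat (1 : ℝ))
  rw [add_zero] at hlim2
  refine le_of_tendsto_of_tendsto' (hlim (F * K) x) hlim2 fun n => ?_
  rw [← add_div, ← add_div]
  refine div_le_div_of_nonneg_right ?_ n.cast_nonneg
  have h3 := (K ^ n).map_le_of_map_zero (F^[n] x)
  rw [coe_pow] at h3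
  linarith [h2 n x hx, Int.ceil_lt_add_one (F^[n] x)]

theorem translationNumber_mul_of_isCircleLift {F K : CircleDeg1Liftˣ} {f k : HomeoPlusCircle}
    (hne : (commonFixedSet G).Nonempty)
    (hF : IsCircleLift F f.1) (hK : IsCircleLift K k.1) (hf : f ∈ G) (hk : k ∈ G) :
    translationNumber (F * K : CircleDeg1Liftˣ) =
      translationNumber (F : CircleDeg1Lift) + translationNumber (K : CircleDeg1Lift) := by
  set S : Set ℝ := {x | (x : UnitAddCircle) ∈ commonFixedSet G}
  have hS : S.Nonempty := by
    obtain ⟨p, hp⟩ := hne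
    induction p using QuotientAddGroup.induction_on with
    | H p => exact ⟨p, hp⟩
  have hinv : ∀ {E : CircleDeg1Liftˣ} {e : HomeoPlusCircle}, IsCircleLift E e.1 → e ∈ G →
      ∀ x ∈ S, E x ∈ S := by
    intro E e hE he x hx
    change ((E x : ℝ) : UnitAddCircle) ∈ commonFixedSet G
    rw [hE.coe_apply]
    exact smul_mem_commonFixedSet he hx
  have key : ∀ {A B : CircleDeg1Liftˣ} {a b : HomeoPlusCircle}, IsCircleLift A a.1 →
      IsCircleLift B b.1 → a ∈ G → b ∈ G → (∀ x ∈ S, A (B x) ≤ B (A x)) →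
      translationNumber (A * B : CircleDeg1Liftˣ) =
      translationNumber (A : CircleDeg1Lift) + translationNumber (B : CircleDeg1Lift) := by
    intro A B a b hA hB ha hb hle
    refine le_antisymm (translationNumber_mul_le_of_forall_le hS (hinv hA ha) (hinv hB hb) hle) ?_
    -- The inverses satisfy the same inequality, which gives the reverse bound because `A * B` and
    -- `B * A` are conjugate.
    have h1 := translationNumber_mul_le_of_forall_le hS (hinv hA.inv (G.inv_mem ha))
      (hinv hB.inv (G.inv_mem hb)) (F := (A⁻¹ : CircleDeg1Liftˣ)) (K := (B⁻¹ : CircleDeg1Liftˣ))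
      (by
        intro x hx
        have hx' : A⁻¹ (B⁻¹ x) ∈ S :=
          hinv hA.inv (G.inv_mem ha) _ (hinv hB.inv (G.inv_mem hb) _ hx)
        have h2 := hle _ hx'
        have h3 := (strictMono_units B⁻¹).monotone ((strictMono_units A⁻¹).monotone h2)
        simp only [units_apply_inv_apply, units_inv_apply_apply] at h3
        exact h3)
    have h5 : translationNumber ((A⁻¹ : CircleDeg1Liftˣ) * (B⁻¹ : CircleDeg1Liftˣ)) =
        - translationNumber (A * B : CircleDeg1Liftˣ) := by
      rw [← Units.val_mul, ← mul_inv_rev, translationNumber_units_inv]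
      have := translationNumber_conj_eq B (A * B : CircleDeg1Liftˣ)
      rw [← Units.val_mul, ← Units.val_mul, ← mul_assoc, mul_inv_cancel_right] at this
      rw [this]
    rw [h5, translationNumber_units_inv, translationNumber_units_inv] at h1
    linarith
  rcases (hF.mul hK).le_or_le_on_commonFixedSet (hK.mul hF) (G.mul_mem hf hk) (G.mul_mem hk hf)
    with h | h
  · exact key hF hK hf hk h
  · have h1 := key hK hF hk hf h
    have := translationNumber_conj_eq F (K * F : CircleDeg1Liftˣ)
    rw [← Units.val_mul, ← Units.val_mul, ← mul_assoc, mul_inv_cancel_right] at this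
    rw [this, h1, add_comm]

theorem rotationNumber_mul_of_nonempty_commonFixedSet (hne : (commonFixedSet G).Nonempty)
    {f g : HomeoPlusCircle} (hf : f ∈ G) (hg : g ∈ G) :
    rotationNumber (f * g) = rotationNumber f + rotationNumber g := by
  obtain ⟨F, hF⟩ := f.2
  obtain ⟨K, hK⟩ := g.2
  have hF : IsCircleLift F f.1 := hF
  rw [rotationNumber_eq_translationNumber (hF.mul hK), rotationNumber_eq_translationNumber hF,
    rotationNumber_eq_translationNumber hK, translationNumber_mul_of_isCircleLift hne hF hK hf hg,
    AddCircle.coe_add]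

end commonFixedSet

/-! ### Left endpoints of complementary intervals and piecewise homeomorphisms -/

/-- The largest point of the preimage of `X` in `ℝ` to the left of `x`. -/
noncomputable def lineLeftEnd (X : Set UnitAddCircle) (x : ℝ) : ℝ :=
  sSup ({z : ℝ | (z : UnitAddCircle) ∈ X} ∩ Set.Iic x)

/-- The left endpoint of the half-open interval of the circle, cut along `X`, that contains `x`. -/
noncomputable def leftEnd (X : Set UnitAddCircle) (x : UnitAddCircle) : UnitAddCircle :=
  (lineLeftEnd X (Quotient.out x) : ℝ)

section leftEnd

variable {X : Set UnitAddCircle}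

theorem isGreatest_lineLeftEnd (hX : IsClosed X) (hne : X.Nonempty) (x : ℝ) :
    IsGreatest ({z : ℝ | (z : UnitAddCircle) ∈ X} ∩ Set.Iic x) (lineLeftEnd X x) := by
  have hbdd : BddAbove ({z : ℝ | (z : UnitAddCircle) ∈ X} ∩ Set.Iic x) := ⟨x, fun z hz => hz.2⟩
  refine ⟨IsClosed.csSup_mem ?_ ?_ hbdd, fun z hz => le_csSup hbdd hz⟩
  · exact (hX.preimage (AddCircle.continuous_mk' (1 : ℝ))).inter isClosed_Iic
  · obtain ⟨p, hp⟩ := hne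
    induction p using QuotientAddGroup.induction_on with
    | H p =>
      refine ⟨p + ⌊x - p⌋, ?_, ?_⟩
      · change ((p + ⌊x - p⌋ : ℝ) : UnitAddCircle) ∈ X
        rwa [UnitAddCircle.coe_add_int]
      · change p + ⌊x - p⌋ ≤ x
        linarith [Int.floor_le (x - p)]

theorem lineLeftEnd_apply (hX : IsClosed X) (hne : X.Nonempty) {F : CircleDeg1Liftˣ}
    {f : HomeoPlusCircle} (hF : IsCircleLift F f.1) (hf : ∀ x ∈ X, f • x ∈ X)
    (hf' : ∀ x ∈ X, f⁻¹ • x ∈ X) (x : ℝ) : lineLeftEnd X (F x) = F (lineLeftEnd X x) := by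
  refine (isGreatest_lineLeftEnd hX hne (F x)).unique ⟨⟨?_, ?_⟩, ?_⟩
  · change ((F (lineLeftEnd X x) : ℝ) : UnitAddCircle) ∈ X
    rw [hF.coe_apply]
    exact hf _ (isGreatest_lineLeftEnd hX hne x).1.1
  · exact (strictMono_units F).monotone (isGreatest_lineLeftEnd hX hne x).1.2
  · rintro z ⟨hz1, hz2⟩
    have h1 : F⁻¹ z ≤ lineLeftEnd X x := by
      refine (isGreatest_lineLeftEnd hX hne x).2 ⟨?_, ?_⟩
      · change (((F⁻¹ : CircleDeg1Liftˣ) z : ℝ) : UnitAddCircle) ∈ X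
        rw [hF.inv.coe_apply]
        exact hf' _ hz1
      · have h2 := (strictMono_units F⁻¹).monotone hz2
        simp only [units_inv_apply_apply] at h2
        exact h2
    have h3 := (strictMono_units F).monotone h1
    simp only [units_apply_inv_apply] at h3
    exact h3

theorem leftEnd_coe (hX : IsClosed X) (hne : X.Nonempty) (x : ℝ) :
    leftEnd X (x : UnitAddCircle) = (lineLeftEnd X x : ℝ) := by
  have h1 : ((Quotient.out (x : UnitAddCircle) : ℝ) : UnitAddCircle) = x := Quotient.out_eq _
  obtain ⟨F, hF, hFx⟩ := HomeoPlusCircle.exists_lift_apply_eq 1 (x := x)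
    (y := Quotient.out (x : UnitAddCircle)) (by rw [one_smul, h1])
  unfold leftEnd
  rw [← hFx, lineLeftEnd_apply hX hne hF (by simp) (by simp), hF.coe_apply, one_smul]

theorem leftEnd_mem (hX : IsClosed X) (hne : X.Nonempty) (x : UnitAddCircle) :
    leftEnd X x ∈ X :=
  (isGreatest_lineLeftEnd hX hne _).1.1

theorem leftEnd_smul (hX : IsClosed X) (hne : X.Nonempty) {f : HomeoPlusCircle}
    (hf : ∀ x ∈ X, f • x ∈ X) (hf' : ∀ x ∈ X, f⁻¹ • x ∈ X) (x : UnitAddCircle) :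
    leftEnd X (f • x) = f • leftEnd X x := by
  induction x using QuotientAddGroup.induction_on with
  | H x =>
    obtain ⟨F, hF⟩ := f.2
    have hF : IsCircleLift F f.1 := hF
    change leftEnd X (f • (x : UnitAddCircle)) = f • leftEnd X (x : UnitAddCircle)
    rw [leftEnd_coe hX hne x, ← hF.coe_apply x, leftEnd_coe hX hne,
      lineLeftEnd_apply hX hne hF hf hf', hF.coe_apply]

/-- Every gap contains the class of a rational, which has the same left endpoint. -/
theorem countable_leftEnd_image_compl (hX : IsClosed X) (hne : X.Nonempty) :
    (leftEnd X '' Xᶜ).Countable := by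
  refine (Set.countable_range fun r : ℚ => ((lineLeftEnd X r : ℝ) : UnitAddCircle)).mono ?_
  rintro _ ⟨x, hx, rfl⟩
  induction x using QuotientAddGroup.induction_on with
  | H x =>
    have hg := isGreatest_lineLeftEnd hX hne x
    have hlt : lineLeftEnd X x < x := lt_of_le_of_ne hg.1.2 fun h => hx (by
      have := hg.1.1
      rwa [h] at this)
    obtain ⟨r, hr1, hr2⟩ := exists_rat_btwn hlt
    refine ⟨r, ?_⟩
    change _ = leftEnd X (x : UnitAddCircle)
    rw [leftEnd_coe hX hne]
    refine congrArg _ ((isGreatest_lineLeftEnd hX hne r).unique ⟨⟨hg.1.1, hr1.le⟩, ?_⟩)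
    exact fun z hz => hg.2 ⟨hz.1, hz.2.trans hr2.le⟩

/-- Homeomorphisms fixing `X` pointwise can be glued along the half-open intervals into which `X`
cuts the circle. -/
theorem exists_piecewise_homeo (hX : IsClosed X) (hne : X.Nonempty)
    (γ : UnitAddCircle → HomeoPlusCircle) (hγ : ∀ x, ∀ z ∈ X, γ x • z = z)
    (hconst : ∀ x y, leftEnd X x = leftEnd X y → γ x = γ y) :
    ∃ ψ : HomeoPlusCircle, ∀ x, ψ • x = γ x • x := by
  obtain ⟨p, hp⟩ : ∃ p : ℝ, (p : UnitAddCircle) ∈ X := by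
    obtain ⟨p, hp⟩ := hne
    induction p using QuotientAddGroup.induction_on with
    | H p => exact ⟨p, hp⟩
  set Γ : UnitAddCircle → CircleDeg1Liftˣ := fun x => liftAt p ⟨γ x, hγ x _ hp⟩
  have hΓl : ∀ x, IsCircleLift (Γ x) (γ x).1 := fun x => isCircleLift_liftAt ⟨γ x, hγ x _ hp⟩
  have hΓX : ∀ x (z : ℝ), (z : UnitAddCircle) ∈ X → Γ x z = z := fun x z hz =>
    liftAt_apply_of_fixed ⟨γ x, hγ x _ hp⟩ (hγ x _ hz)
  have hΓc : ∀ x y : ℝ, lineLeftEnd X x = lineLeftEnd X y →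
      Γ (x : UnitAddCircle) = Γ (y : UnitAddCircle) := by
    intro x y h
    have h1 := hconst x y (by rw [leftEnd_coe hX hne, leftEnd_coe hX hne, h])
    exact congrArg (liftAt p) (Subtype.ext h1)
  have hmono : StrictMono fun x : ℝ => Γ (x : UnitAddCircle) x := by
    intro x y hxy
    have hgx := isGreatest_lineLeftEnd hX hne x
    have hgy := isGreatest_lineLeftEnd hX hne y
    by_cases h : lineLeftEnd X x = lineLeftEnd X y
    · simp only [hΓc x y h]
      exact strictMono_units _ hxy
    -- The left end of `y` separates the two points and is fixed by both lifts.
    · have hlt : x < lineLeftEnd X y := by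
        by_contra! hle
        exact h (le_antisymm (hgy.2 ⟨hgx.1.1, hgx.1.2.trans hxy.le⟩) (hgx.2 ⟨hgy.1.1, hle⟩))
      have h1 := strictMono_units (Γ (x : UnitAddCircle)) hlt
      have h2 := (strictMono_units (Γ (y : UnitAddCircle))).monotone hgy.1.2
      simp only [hΓX _ _ hgy.1.1] at h1 h2
      exact h1.trans_le h2
  set Ψ : CircleDeg1Lift := ⟨⟨fun x : ℝ => Γ (x : UnitAddCircle) x, hmono.monotone⟩, by
    intro x
    change Γ ((x + 1 : ℝ) : UnitAddCircle) (x + 1) = Γ (x : UnitAddCircle) x + 1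
    have h1 : ((x + 1 : ℝ) : UnitAddCircle) = x := by simp
    rw [h1, map_add_one]⟩
  have hΨa : ∀ x : ℝ, Ψ x = Γ (x : UnitAddCircle) x := fun _ => rfl
  have hbij : Function.Bijective Ψ := by
    refine ⟨hmono.injective, fun y => ⟨(Γ (y : UnitAddCircle))⁻¹ y, ?_⟩⟩
    -- The candidate preimage of `y` stays in the piece of `y`, so the glued map acts on it by the
    -- same lift.
    have h1 : lineLeftEnd X ((Γ (y : UnitAddCircle))⁻¹ y) = lineLeftEnd X y := by
      have hy := hγ (y : UnitAddCircle)
      have hfix : ∀ z ∈ X, (γ (y : UnitAddCircle))⁻¹ • z = z := fun z hz =>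
        inv_smul_eq_iff.2 (hy z hz).symm
      rw [lineLeftEnd_apply hX hne (hΓl _).inv (fun z hz => by rwa [hfix z hz])
        (fun z hz => by rwa [inv_inv, hy z hz])]
      conv_lhs => rw [← hΓX (y : UnitAddCircle) _ (isGreatest_lineLeftEnd hX hne y).1.1]
      rw [units_inv_apply_apply]
    rw [hΨa, hΓc _ _ h1, units_apply_inv_apply]
  obtain ⟨U, hU⟩ := isUnit_iff_bijective.2 hbij
  refine ⟨toHomeoPlusCircle U, fun x => ?_⟩
  induction x using QuotientAddGroup.induction_on with
  | H x =>
    erw [toHomeoPlusCircle_smul, hU, hΨa, (hΓl _).coe_apply]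

end leftEnd

/-! ### Homeomorphisms of the circle with a fixed point as homeomorphisms of the interval -/

/-- Cutting the circle open at `p`. -/
noncomputable def cutAt (p : ℝ) :
    MulAction.stabilizer HomeoPlusCircle (p : UnitAddCircle) →* HomeoPlusInterval := by
  have hmem : ∀ (f : MulAction.stabilizer HomeoPlusCircle (p : UnitAddCircle)) (t : unitInterval),
      liftAt p f (p + t) - p ∈ unitInterval := by
    intro f t
    have hm := (strictMono_units (liftAt p f)).monotone
    have h0 := hm (show p ≤ p + t from le_add_of_nonneg_right t.2.1)
    have h1 := hm (show p + t ≤ p + 1 from by linarith [t.2.2])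
    simp only [map_add_one, liftAt_apply_self] at h0 h1
    exact ⟨by linarith, by linarith⟩
  have hmono : ∀ f : MulAction.stabilizer HomeoPlusCircle (p : UnitAddCircle),
      StrictMono fun t : unitInterval =>
        (⟨liftAt p f (p + t) - p, hmem f t⟩ : unitInterval) := by
    intro f s t hst
    have hst' : (s : ℝ) < t := hst
    have h := strictMono_units (liftAt p f) (show p + (s : ℝ) < p + t by linarith)
    exact Subtype.mk_lt_mk.2 (sub_lt_sub_right h p)
  have hcomp : ∀ (f g : MulAction.stabilizer HomeoPlusCircle (p : UnitAddCircle))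
      (t : unitInterval), liftAt p (f * g) (p + t) - p =
        liftAt p f (p + (⟨liftAt p g (p + t) - p, hmem g t⟩ : unitInterval)) - p := by
    intro f g t
    rw [map_mul]
    simp
  have hone : ∀ t : unitInterval, liftAt p 1 (p + t) - p = t := by
    intro t
    rw [map_one]
    simp
  refine MonoidHom.mk' (fun f => ⟨(Equiv.toOrderIso (α := unitInterval) (β := unitInterval)
    ⟨fun t => ⟨liftAt p f (p + t) - p, hmem f t⟩,
      fun t => ⟨liftAt p f⁻¹ (p + t) - p, hmem f⁻¹ t⟩, ?_, ?_⟩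
    (hmono f).monotone (hmono f⁻¹).monotone).toHomeomorph, hmono f⟩) ?_
  · intro t
    exact Subtype.ext ((hcomp f⁻¹ f t).symm.trans (by rw [inv_mul_cancel, hone]))
  · intro t
    exact Subtype.ext ((hcomp f f⁻¹ t).symm.trans (by rw [mul_inv_cancel, hone]))
  · intro f g
    refine Subtype.ext (Homeomorph.ext fun t => Subtype.ext ?_)
    exact hcomp f g t

theorem cutAt_apply (p : ℝ) (f : MulAction.stabilizer HomeoPlusCircle (p : UnitAddCircle))
    (t : unitInterval) : (((cutAt p f).1 t : unitInterval) : ℝ) = liftAt p f (p + t) - p := rfl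

theorem cutAt_injective (p : ℝ) : Function.Injective (cutAt p) := by
  intro f g h
  refine Subtype.ext (HomeoPlusCircle.ext_smul fun x => ?_)
  obtain ⟨y, hy, rfl⟩ : ∃ y ∈ Set.Ico p (p + 1), (y : UnitAddCircle) = x :=
    ⟨_, (AddCircle.equivIco 1 p x).2, AddCircle.coe_equivIco⟩
  have h1 := cutAt_apply p f ⟨y - p, by linarith [hy.1], by linarith [hy.2]⟩
  rw [h, cutAt_apply] at h1
  simp only [add_sub_cancel] at h1
  rw [← (isCircleLift_liftAt f).coe_apply, ← (isCircleLift_liftAt g).coe_apply]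
  exact congrArg _ (sub_left_injective h1).symm

/-! ### Groups without free subgroups and restricted wreath products -/

theorem NoNonabelianFreeSubgroup.of_injective {A B : Type*} [Group A] [Group B]
    (hB : NoNonabelianFreeSubgroup B) {φ : A →* B} (hφ : Function.Injective φ) :
    NoNonabelianFreeSubgroup A := by
  intro K hK x y
  let e : K ≃* K.map φ := K.equivMapOfInjective φ hφ
  have h := hB (K.map φ) (IsFreeGroup.ofMulEquiv e) (e x) (e y)
  rw [← map_mul, ← map_mul] at h
  exact e.injective h

/-- A free subgroup of `B` lifts isomorphically to `A`: send its free generators to arbitrary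
preimages. -/
theorem NoNonabelianFreeSubgroup.of_surjective {A B : Type*} [Group A] [Group B]
    (hA : NoNonabelianFreeSubgroup A) {φ : A →* B} (hφ : Function.Surjective φ) :
    NoNonabelianFreeSubgroup B := by
  intro K hK x y
  choose σ hσ using hφ
  let ψ : K →* A := IsFreeGroup.lift fun a => σ (IsFreeGroup.of a : K)
  have hψ : φ.comp ψ = K.subtype := IsFreeGroup.ext_hom fun a => by
    simp [ψ, hσ]
  have hinj : Function.Injective ψ := by
    refine Function.Injective.of_comp (f := φ) ?_
    rw [← MonoidHom.coe_comp, hψ]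
    exact K.subtype_injective
  let e : K ≃* ψ.range := MonoidHom.ofInjective hinj
  have h := hA ψ.range (IsFreeGroup.ofMulEquiv e) (e x) (e y)
  rw [← map_mul, ← map_mul] at h
  exact e.injective h

/-- Conjugating the factor at 1 by `inl t` gives the factor at `t`, and finitely supported functions
are finite products of such elements. -/
theorem restrictedWreath_eq_sup (C T : Type*) [Group C] [Group T] :
    restrictedWreath C T = (wreathBase C T).range ⊔ (RegularWreathProduct.inl (D := C)).range := by
  classical
  refine le_antisymm (fun w hw => ?_) (sup_le ?_ ?_)
  · have hw' : (Function.mulSupport w.left).Finite := hw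
    have hinl : ∀ t : T, (RegularWreathProduct.inl t : C ≀ᵣ T) ∈
        (wreathBase C T).range ⊔ (RegularWreathProduct.inl (D := C)).range :=
      fun t => Subgroup.mem_sup_right ⟨t, rfl⟩
    have hsingle : ∀ (t : T) (c : C), (⟨Pi.mulSingle t c, 1⟩ : C ≀ᵣ T) ∈
        (wreathBase C T).range ⊔ (RegularWreathProduct.inl (D := C)).range := by
      intro t c
      have h := mul_mem (mul_mem (hinl t) (Subgroup.mem_sup_left ⟨c, rfl⟩)) (inv_mem (hinl t))
      convert h using 1
      ext v
      · change (Pi.mulSingle t c : T → C) v =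
          (1 * (Pi.mulSingle (1 : T) c : T → C) (t⁻¹ * v)) * (1 : C)⁻¹
        by_cases hv : v = t
        · subst hv
          simp
        · have : t⁻¹ * v ≠ 1 := fun h => hv (inv_mul_eq_one.1 h).symm
          simp [hv, this]
      · change (1 : T) = t * 1 * t⁻¹
        simp
    have hbase : ∀ (s : Finset T) (f : T → C), Function.mulSupport f ⊆ s →
        (⟨f, 1⟩ : C ≀ᵣ T) ∈
          (wreathBase C T).range ⊔ (RegularWreathProduct.inl (D := C)).range := by
      intro s
      induction s using Finset.induction_on with
      | empty =>
        intro f hf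
        have : f = 1 := Function.mulSupport_eq_empty_iff.1 (by simpa using hf)
        subst this
        exact one_mem _
      | insert a s ha ih =>
        intro f hf
        have h := mul_mem (hsingle a (f a)) (ih (Function.update f a 1) (by
          intro t ht
          by_cases hta : t = a
          · subst hta
            simp at ht
          · have ht' : t ∈ Function.mulSupport f := by simpa [hta] using ht
            exact (Finset.mem_insert.1 (hf ht')).resolve_left hta))
        convert h using 1
        ext v
        · by_cases hv : v = a
          · subst hv
            simp
          · simp [hv]
        · simp
    have h := mul_mem (hbase hw'.toFinset w.left (by simp)) (hinl w.right)
    convert h using 1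
    ext v <;> simp
  · rintro _ ⟨c, rfl⟩
    exact wreathBase_mem_restrictedWreath C T c
  · rintro _ ⟨t, rfl⟩
    exact inl_mem_restrictedWreath C T t

/-! ### Wreath products from gluing -/

/-- An equivariant map from a `G`-set `Ω` to `G ⧸ N` such that elements of `N` can be glued along
its fibres, to elements of an ambient group `Γ`. -/
structure FibreGluing {Γ : Type*} [Group Γ] (Ω : Type*) [MulAction Γ Ω] (G : Subgroup Γ)
    (N : Subgroup G) [N.Normal] where
  /-- The equivariant map. -/
  index : Ω → G ⧸ N
  index_smul : ∀ (g : G) (x : Ω), index (g • x) = QuotientGroup.mk g * index x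
  /-- The glued element. -/
  glue : (G ⧸ N → N) → Γ
  glue_smul : ∀ (γ : G ⧸ N → N) (x : Ω), glue γ • x = (γ (index x) : G) • x

namespace FibreGluing

variable {Γ : Type*} [Group Γ] {Ω : Type*} [MulAction Γ Ω] {G : Subgroup Γ}
  {N : Subgroup G} [N.Normal] (D : FibreGluing Ω G N)

open Classical in
/-- Coset representatives, with `1` representing the trivial coset. -/
noncomputable def rep (t : G ⧸ N) : G := if t = 1 then 1 else t.out

theorem rep_one : rep (1 : G ⧸ N) = 1 := if_pos rfl

theorem mk_rep (t : G ⧸ N) : (QuotientGroup.mk (rep t) : G ⧸ N) = t := by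
  by_cases h : t = 1
  · subst h
    rw [rep_one, QuotientGroup.mk_one]
  · rw [rep, if_neg h, QuotientGroup.out_eq']

theorem index_smul_normal (k : N) (x : Ω) : D.index ((k : G) • x) = D.index x := by
  rw [D.index_smul, (QuotientGroup.eq_one_iff _).2 k.2, one_mul]

variable [FaithfulSMul Γ Ω]

open Classical in
/-- The elements of `N`, restricted to the fibre over `1`. -/
noncomputable def restrictHom : N →* Γ :=
  MonoidHom.mk' (fun k => D.glue (Pi.mulSingle 1 k)) (by
    intro k l
    refine FaithfulSMul.eq_of_smul_eq_smul (α := Ω) fun x => ?_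
    rw [mul_smul, D.glue_smul, D.glue_smul, D.glue_smul, D.index_smul_normal]
    simp [mul_smul, Pi.mulSingle_mul])

open Classical in
theorem restrictHom_smul_of_index_eq_one (k : N) {x : Ω} (hx : D.index x = 1) :
    D.restrictHom k • x = (k : G) • x := by
  change D.glue _ • x = _
  rw [D.glue_smul, hx, Pi.mulSingle_eq_same]

open Classical in
theorem restrictHom_smul_of_index_ne_one (k : N) {x : Ω} (hx : D.index x ≠ 1) :
    D.restrictHom k • x = x := by
  change D.glue _ • x = _
  rw [D.glue_smul, Pi.mulSingle_eq_of_ne (M := fun _ => N) hx, OneMemClass.coe_one, one_smul]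

theorem index_restrictHom_smul (k : N) (x : Ω) :
    D.index (D.restrictHom k • x) = D.index x := by
  change D.index (D.glue _ • x) = _
  rw [D.glue_smul, D.index_smul_normal]

omit [FaithfulSMul Γ Ω] in
-- The map is `rep t` up to a correction on each fibre; the correction lies in `N`, so it can be
-- glued.
theorem exists_shift (t : G ⧸ N) :
    ∃ ψ : Γ, ∀ x, ψ • x = (rep (t * D.index x) * (rep (D.index x))⁻¹) • x := by
  have hmem : ∀ v : G ⧸ N, (rep t)⁻¹ * (rep (t * v) * (rep v)⁻¹) ∈ N := by
    intro v
    rw [← QuotientGroup.eq_one_iff]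
    simp only [QuotientGroup.mk_mul, QuotientGroup.mk_inv, mk_rep]
    group
  refine ⟨rep t * D.glue fun v => ⟨_, hmem v⟩, fun x => ?_⟩
  rw [mul_smul, D.glue_smul, ← Subgroup.smul_def, smul_smul, mul_inv_cancel_left]

/-- The action of `G ⧸ N` on `Ω` that permutes the fibres via coset representatives. -/
noncomputable def shift : G ⧸ N →* Γ :=
  MonoidHom.mk' (fun t => (D.exists_shift t).choose) (by
    intro t t'
    refine FaithfulSMul.eq_of_smul_eq_smul (α := Ω) fun x => ?_
    rw [mul_smul, (D.exists_shift _).choose_spec, (D.exists_shift _).choose_spec,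
      (D.exists_shift _).choose_spec, D.index_smul]
    -- Over `v` the product rep(tt'v)rep(t'v)⁻¹ · rep(t'v)rep(v)⁻¹ telescopes.
    simp only [QuotientGroup.mk_mul, QuotientGroup.mk_inv, mk_rep, inv_mul_cancel_right,
      smul_smul]
    congr 1
    group)

theorem shift_smul (t : G ⧸ N) (x : Ω) :
    D.shift t • x = (rep (t * D.index x) * (rep (D.index x))⁻¹) • x :=
  (D.exists_shift t).choose_spec x

theorem index_shift_smul (t : G ⧸ N) (x : Ω) : D.index (D.shift t • x) = t * D.index x := by
  rw [D.shift_smul, D.index_smul]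
  simp [mk_rep]

theorem shift_injective [Nonempty Ω] : Function.Injective D.shift := by
  refine (injective_iff_map_eq_one _).2 fun t ht => ?_
  obtain ⟨x⟩ := ‹Nonempty Ω›
  have h := D.index_shift_smul t x
  rw [ht, one_smul] at h
  exact (mul_eq_right.1 h.symm)

theorem index_smul_restrictRange (h : D.restrictHom.range) (x : Ω) :
    D.index ((h : Γ) • x) = D.index x := by
  obtain ⟨_, k, rfl⟩ := h
  exact D.index_restrictHom_smul k x

theorem smul_restrictRange_of_index_ne_one (h : D.restrictHom.range) {x : Ω}
    (hx : D.index x ≠ 1) : (h : Γ) • x = x := by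
  obtain ⟨_, k, rfl⟩ := h
  exact D.restrictHom_smul_of_index_ne_one k hx

/-- `G ⧸ N` as a group of shifts, in `Γ`. -/
noncomputable def shiftEquiv [Nonempty Ω] : G ⧸ N ≃* D.shift.range :=
  MonoidHom.ofInjective D.shift_injective

variable [Nonempty Ω]

theorem coe_shiftEquiv (t : G ⧸ N) : (D.shiftEquiv t : Γ) = D.shift t := rfl

theorem coe_eq_shift (q : D.shift.range) : (q : Γ) = D.shift (D.shiftEquiv.symm q) := by
  rw [← coe_shiftEquiv, MulEquiv.apply_symm_apply]

theorem exists_base (f : D.shift.range → D.restrictHom.range) :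
    ∃ ψ : Γ, ∀ x, ψ • x = D.shift (D.index x) •
      ((f (D.shiftEquiv (D.index x)) : Γ) • ((D.shift (D.index x))⁻¹ • x)) := by
  have hk : ∀ v : G ⧸ N, ∃ k : N, D.restrictHom k = f (D.shiftEquiv v) := fun v => (f _).2
  choose k hk using hk
  refine ⟨D.glue fun v => ⟨rep v * k v * (rep v)⁻¹, Subgroup.Normal.conj_mem ‹_› _ (k v).2 _⟩,
    fun x => ?_⟩
  -- Since `rep 1 = 1`, shifting between the fibres over 1 and `v` is the action of `rep v`; so the
  -- glued element is a conjugate of `k v` in `N`.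
  have h1 : (D.shift (D.index x))⁻¹ • x = (rep (D.index x))⁻¹ • x := by
    rw [← map_inv, D.shift_smul, inv_mul_cancel, rep_one, one_mul]
  have h2 : D.index ((rep (D.index x))⁻¹ • x) = 1 := by
    rw [D.index_smul, QuotientGroup.mk_inv, mk_rep, inv_mul_cancel]
  rw [D.glue_smul, h1, ← hk, D.restrictHom_smul_of_index_eq_one _ h2, D.shift_smul,
    D.index_smul_normal, h2, mul_one, rep_one, inv_one, mul_one, mul_smul, mul_smul]

/-- The element of `Γ` that acts on the fibre over `v` by the `v`-th component of `f`. -/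
noncomputable def base (f : D.shift.range → D.restrictHom.range) : Γ := (D.exists_base f).choose

theorem base_smul (f : D.shift.range → D.restrictHom.range) (x : Ω) :
    D.base f • x = D.shift (D.index x) •
      ((f (D.shiftEquiv (D.index x)) : Γ) • ((D.shift (D.index x))⁻¹ • x)) :=
  (D.exists_base f).choose_spec x

theorem index_base_smul (f : D.shift.range → D.restrictHom.range) (x : Ω) :
    D.index (D.base f • x) = D.index x := by
  rw [base_smul, index_shift_smul, index_smul_restrictRange, ← map_inv, index_shift_smul,
    inv_mul_cancel, mul_one]

/-- This is the multiplication rule of the wreath product, from which `wreathHom` is a homomorphism.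
-/
theorem base_mul_shift (f f' : D.shift.range → D.restrictHom.range) (q : D.shift.range) :
    D.base (f * fun v => f' (q⁻¹ * v)) * q = D.base f * (q * D.base f') := by
  refine FaithfulSMul.eq_of_smul_eq_smul (α := Ω) fun x => ?_
  rw [coe_eq_shift]
  set t := D.shiftEquiv.symm q with ht
  have hq : q = D.shiftEquiv t := by simp [ht]
  have h1 : q⁻¹ * D.shiftEquiv (t * D.index x) = D.shiftEquiv (D.index x) := by
    rw [hq, ← map_inv, ← map_mul, inv_mul_cancel_left]
  have h2 : ∀ y : Ω, (D.shift (t * D.index x))⁻¹ • D.shift t • y = (D.shift (D.index x))⁻¹ • y :=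
    fun y => by rw [map_mul, mul_inv_rev, mul_smul, inv_smul_smul]
  rw [mul_smul, mul_smul, mul_smul, base_smul, base_smul D f, index_shift_smul, index_shift_smul,
    index_base_smul, base_smul D f', Pi.mul_apply, h1, h2, h2, Subgroup.coe_mul, mul_smul,
    inv_smul_smul]

/-- The action on `Ω` of the unrestricted wreath product. -/
noncomputable def wreathHom : D.restrictHom.range ≀ᵣ D.shift.range →* Γ :=
  MonoidHom.mk' (fun w => D.base w.left * w.right) (by
    intro w w'
    rw [RegularWreathProduct.mul_left, RegularWreathProduct.mul_right, Subgroup.coe_mul,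
      ← mul_assoc, base_mul_shift]
    group)

theorem wreathHom_apply (w : D.restrictHom.range ≀ᵣ D.shift.range) :
    D.wreathHom w = D.base w.left * w.right := rfl

theorem wreathHom_injective : Function.Injective D.wreathHom := by
  refine (injective_iff_map_eq_one _).2 fun w hw => ?_
  rw [wreathHom_apply] at hw
  have hright : w.right = 1 := by
    obtain ⟨x⟩ := ‹Nonempty Ω›
    have h : D.index ((D.base w.left * w.right) • x) = D.index x := by rw [hw, one_smul]
    rw [mul_smul, index_base_smul, coe_eq_shift, index_shift_smul, mul_eq_right] at h
    simpa using h
  rw [hright, OneMemClass.coe_one, mul_one] at hw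
  refine RegularWreathProduct.ext (funext fun q => ?_) hright
  refine Subtype.ext (FaithfulSMul.eq_of_smul_eq_smul (α := Ω) fun x => ?_)
  rw [RegularWreathProduct.one_left, Pi.one_apply, OneMemClass.coe_one, one_smul]
  -- An element of the restricted group is determined on the fibre over 1; the component at `q` is
  -- read off on the fibre indexed by `q`.
  by_cases hx : D.index x = 1
  · have h := D.base_smul w.left (D.shift (D.shiftEquiv.symm q) • x)
    rw [hw, one_smul, index_shift_smul, hx, mul_one, inv_smul_smul,
      MulEquiv.apply_symm_apply] at h
    exact (MulAction.injective _ h).symm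
  · exact D.smul_restrictRange_of_index_ne_one _ hx

theorem wreathHom_inl (q : D.shift.range) :
    D.wreathHom (RegularWreathProduct.inl q) = q := by
  have h1 : D.base 1 = 1 := FaithfulSMul.eq_of_smul_eq_smul (α := Ω) fun x => by
    rw [base_smul]
    simp
  rw [wreathHom_apply, RegularWreathProduct.left_inl, RegularWreathProduct.right_inl, h1, one_mul]

theorem wreathHom_wreathBase (h : D.restrictHom.range) :
    D.wreathHom (wreathBase _ _ h) = h := by
  classical
  refine FaithfulSMul.eq_of_smul_eq_smul (α := Ω) fun x => ?_
  have hleft : (wreathBase D.restrictHom.range D.shift.range h).left = Pi.mulSingle 1 h := by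
    simp only [wreathBase, MonoidHom.coe_mk, OneHom.coe_mk]
    congr!
  have hright : (wreathBase D.restrictHom.range D.shift.range h).right = 1 := rfl
  rw [wreathHom_apply, hleft, hright, OneMemClass.coe_one, mul_one, base_smul]
  by_cases hx : D.index x = 1
  · simp [hx]
  · rw [Pi.mulSingle_eq_of_ne (M := fun _ => D.restrictHom.range)
      (fun h => hx (D.shiftEquiv.injective (h.trans (map_one _).symm))),
      D.smul_restrictRange_of_index_ne_one _ hx]
    simp

theorem map_wreathHom_restrictedWreath :
    (restrictedWreath D.restrictHom.range D.shift.range).map D.wreathHom =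
      D.restrictHom.range ⊔ D.shift.range := by
  rw [restrictedWreath_eq_sup, Subgroup.map_sup]
  congr 1
  · ext x
    simp [wreathHom_wreathBase]
  · ext x
    simp [wreathHom_inl]

/-- The restricted wreath product is generated by the base group and the shifts. -/
noncomputable def restrictedWreathEquiv :
    restrictedWreath D.restrictHom.range D.shift.range ≃*
      (D.restrictHom.range ⊔ D.shift.range : Subgroup Γ) :=
  (Subgroup.equivMapOfInjective _ D.wreathHom D.wreathHom_injective).trans
    (MulEquiv.subgroupCongr D.map_wreathHom_restrictedWreath)

theorem coe_restrictedWreathEquiv (w : restrictedWreath D.restrictHom.range D.shift.range) :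
    (D.restrictedWreathEquiv w : Γ) = D.wreathHom w := rfl

/-- The Kaloujnine–Krasner formula: the component at `v` is rep(v)⁻¹ g rep(t⁻¹v), which lies in `N`
when `t` is the class of `g`. -/
theorem exists_wreathHom_eq (g : G) :
    ∃ w, D.wreathHom w = g ∧ w.right = D.shiftEquiv (QuotientGroup.mk g) := by
  set t : G ⧸ N := QuotientGroup.mk g with ht
  have hmem : ∀ v : G ⧸ N, (rep v)⁻¹ * g * rep (t⁻¹ * v) ∈ N := by
    intro v
    rw [← QuotientGroup.eq_one_iff]
    simp only [QuotientGroup.mk_mul, QuotientGroup.mk_inv, mk_rep, ← ht]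
    group
  let f : D.shift.range → D.restrictHom.range := fun q =>
    ⟨D.restrictHom ⟨_, hmem (D.shiftEquiv.symm q)⟩, MonoidHom.mem_range.2 ⟨_, rfl⟩⟩
  have hf : ∀ v, (f (D.shiftEquiv v) : Γ) = D.restrictHom ⟨_, hmem v⟩ := fun v => by
    simp only [f, MulEquiv.symm_apply_apply]
  refine ⟨⟨f, D.shiftEquiv t⟩, ?_, rfl⟩
  refine FaithfulSMul.eq_of_smul_eq_smul (α := Ω) fun x => ?_
  rw [wreathHom_apply, mul_smul, base_smul, coe_shiftEquiv, index_shift_smul, hf]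
  have h1 : (D.shift (t * D.index x))⁻¹ • D.shift t • x = (rep (D.index x))⁻¹ • x := by
    rw [map_mul, mul_inv_rev, mul_smul, inv_smul_smul, ← map_inv, D.shift_smul, inv_mul_cancel,
      rep_one, one_mul]
  have h2 : D.index ((rep (D.index x))⁻¹ • x) = 1 := by
    rw [D.index_smul, QuotientGroup.mk_inv, mk_rep, inv_mul_cancel]
  rw [h1, D.restrictHom_smul_of_index_eq_one _ h2, D.shift_smul, D.index_smul_normal, h2,
    mul_one, rep_one, inv_one, mul_one, smul_smul, smul_smul]
  change (rep (t * D.index x) * ((rep (t * D.index x))⁻¹ * g * rep (t⁻¹ * (t * D.index x))) *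
    (rep (D.index x))⁻¹) • x = g • x
  rw [inv_mul_cancel_left]
  simp only [mul_assoc, mul_inv_cancel_left, mul_inv_cancel, mul_one]

/-- The embedding of `G` in the wreath product. -/
noncomputable def embedding : G →* D.restrictHom.range ≀ᵣ D.shift.range :=
  MonoidHom.mk' (fun g => (D.exists_wreathHom_eq g).choose) (fun g g' => by
    apply D.wreathHom_injective
    rw [map_mul, (D.exists_wreathHom_eq _).choose_spec.1, (D.exists_wreathHom_eq _).choose_spec.1,
      (D.exists_wreathHom_eq _).choose_spec.1, Subgroup.coe_mul])

theorem wreathHom_embedding (g : G) : D.wreathHom (D.embedding g) = g :=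
  (D.exists_wreathHom_eq g).choose_spec.1

theorem embedding_right (g : G) : (D.embedding g).right = D.shiftEquiv (QuotientGroup.mk g) :=
  (D.exists_wreathHom_eq g).choose_spec.2

theorem embedding_injective : Function.Injective D.embedding := fun g g' h => by
  have h1 := congrArg D.wreathHom h
  rwa [wreathHom_embedding, wreathHom_embedding, Subtype.coe_inj] at h1

end FibreGluing

/-! ### Circle homeomorphism groups without free subgroups -/

instance : FaithfulSMul HomeoPlusCircle UnitAddCircle where
  eq_of_smul_eq_smul h := HomeoPlusCircle.ext_smul h

section

variable {G : Subgroup HomeoPlusCircle}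

theorem NoNonabelianFreeSubgroup.nonempty_commonFixedSet (hG : NoNonabelianFreeSubgroup G) :
    (commonFixedSet G).Nonempty :=
  hG.exists_global_fixed

/-- The rotation number as a homomorphism. -/
noncomputable def rotationHom (hne : (commonFixedSet G).Nonempty) :
    G →* Multiplicative UnitAddCircle :=
  MonoidHom.mk' (fun g => Multiplicative.ofAdd (rotationNumber g.1)) fun f g =>
    congrArg _ (rotationNumber_mul_of_nonempty_commonFixedSet hne f.2 g.2)

variable (hne : (commonFixedSet G).Nonempty)

theorem mem_ker_rotationHom {g : G} :
    g ∈ (rotationHom hne).ker ↔ ∃ x : UnitAddCircle, g • x = x :=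
  (MonoidHom.mem_ker).trans rotationNumber_eq_zero_iff

theorem smul_eq_of_mem_ker_rotationHom {g : G} (hg : g ∈ (rotationHom hne).ker)
    {x : UnitAddCircle} (hx : x ∈ commonFixedSet G) : g • x = x :=
  hx g.1 g.2 ((mem_ker_rotationHom hne).1 hg)

theorem leftEnd_commonFixedSet_smul (hne : (commonFixedSet G).Nonempty) (g : G) (x : UnitAddCircle) :
    leftEnd (commonFixedSet G) (g • x) = g • leftEnd (commonFixedSet G) x :=
  leftEnd_smul isClosed_commonFixedSet hne (fun _ => smul_mem_commonFixedSet g.2)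
    (fun _ => smul_mem_commonFixedSet (G.inv_mem g.2)) x

/-- Compare each left endpoint with a chosen representative of its orbit. The element carrying one
to the other is unique modulo the kernel, since stabilizers of points consist of elements of
rotation number zero. -/
theorem exists_index : ∃ u : UnitAddCircle → G ⧸ (rotationHom hne).ker,
    (∀ (g : G) (x : UnitAddCircle), u (g • x) = QuotientGroup.mk g * u x) ∧
      ∀ x y, leftEnd (commonFixedSet G) x = leftEnd (commonFixedSet G) y → u x = u y := by
  let o : UnitAddCircle → UnitAddCircle := fun z =>
    (Quotient.mk (MulAction.orbitRel G UnitAddCircle) z).out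
  have ho : ∀ z, ∃ g : G, g • o z = z := fun z =>
    (MulAction.orbitRel G UnitAddCircle).symm (Quotient.mk_out z)
  have hoz : ∀ (g : G) z, o (g • z) = o z := fun g z =>
    congrArg Quotient.out (Quotient.sound ⟨g, rfl⟩)
  choose k hk using ho
  refine ⟨fun x => QuotientGroup.mk (k (leftEnd (commonFixedSet G) x)), fun g x => ?_,
    fun x y h => by simp only [h]⟩
  rw [← QuotientGroup.mk_mul, eq_comm, QuotientGroup.eq, mem_ker_rotationHom,
    leftEnd_commonFixedSet_smul hne]
  refine ⟨o (leftEnd (commonFixedSet G) x), ?_⟩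
  have h := hk (g • leftEnd (commonFixedSet G) x)
  rw [hoz] at h
  rw [mul_smul, h, inv_smul_eq_iff, mul_smul, hk]

/-- Elements of `G` with rotation number zero can be glued along the intervals cut out by their
common fixed points. -/
theorem nonempty_fibreGluing : Nonempty (FibreGluing UnitAddCircle G (rotationHom hne).ker) := by
  obtain ⟨u, hu, hconst⟩ := exists_index hne
  have hglue : ∀ γ : G ⧸ (rotationHom hne).ker → (rotationHom hne).ker, ∃ ψ : HomeoPlusCircle,
      ∀ x : UnitAddCircle, ψ • x = (γ (u x) : G) • x := fun γ =>
    exists_piecewise_homeo isClosed_commonFixedSet hne (fun x => ((γ (u x) : G) : HomeoPlusCircle))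
      (fun x z hz => smul_eq_of_mem_ker_rotationHom hne (γ (u x)).2 hz)
      (fun x y h => by rw [hconst x y h])
  choose glue hglue using hglue
  exact ⟨⟨u, hu, glue, hglue⟩⟩

/-- A nontrivial kernel element moves a point, which must lie in a gap. Distinct cosets move the
left endpoint of that gap to distinct endpoints of gaps, and these are countably many. -/
theorem countable_quotient_ker_rotationHom (hker : (rotationHom hne).ker ≠ ⊥) :
    Countable (G ⧸ (rotationHom hne).ker) := by
  obtain ⟨k, hk, hk1⟩ := (Subgroup.bot_or_exists_ne_one _).resolve_left hker
  obtain ⟨x, hx⟩ : ∃ x : UnitAddCircle, k • x ≠ x := by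
    by_contra! h
    exact hk1 (FaithfulSMul.eq_of_smul_eq_smul (α := UnitAddCircle) fun x => by
      rw [h x, one_smul])
  have hxX : x ∉ commonFixedSet G := fun h => hx (smul_eq_of_mem_ker_rotationHom hne hk h)
  have hcount := (countable_leftEnd_image_compl (isClosed_commonFixedSet (G := G)) hne).to_subtype
  let X := commonFixedSet G
  have hmem : ∀ t : G ⧸ (rotationHom hne).ker, t.out • leftEnd X x ∈ leftEnd X '' Xᶜ := by
    intro t
    refine ⟨t.out • x, fun h => hxX ?_, leftEnd_commonFixedSet_smul hne _ _⟩
    have h1 := smul_mem_commonFixedSet (G.inv_mem t.out.2) h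
    rwa [Subgroup.smul_def, inv_smul_smul] at h1
  refine Function.Injective.countable (β := leftEnd X '' Xᶜ)
    (f := fun t => ⟨t.out • leftEnd X x, hmem t⟩) fun s t hst => ?_
  have h : s.out • leftEnd X x = t.out • leftEnd X x := congrArg Subtype.val hst
  rw [← QuotientGroup.out_eq' s, ← QuotientGroup.out_eq' t, QuotientGroup.eq,
    mem_ker_rotationHom]
  exact ⟨leftEnd X x, by rw [mul_smul, ← h, inv_smul_smul]⟩

end

theorem theorem1p1 (G : Subgroup HomeoPlusCircle) (hG : NoNonabelianFreeSubgroup G) :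
    (∀ x ∈ G, ∀ y ∈ G, x * y = y * x) ∨
    ∃ H₀ Q : Subgroup HomeoPlusCircle,
      -- properties of `H₀`
      (∀ h ∈ H₀, rotationNumber h = 0) ∧
      (∃ (N : Type) (_ : Countable N) (a : H₀ →* (N → HomeoPlusInterval)),
        Function.Injective a) ∧
      NoNonabelianFreeSubgroup H₀ ∧
      -- `Q` is isomorphic to a countable subgroup of `ℝ / ℤ`
      (∃ A : AddSubgroup UnitAddCircle, Countable A ∧ Nonempty (Q ≃* Multiplicative A)) ∧
      -- the embedding `j` of `G`
      ∃ j : G →* H₀ ≀ᵣ Q, Function.Injective j ∧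
        -- the rotation number is a homomorphism `ρ` on `G`, and `j` followed by the projection
        -- to `Q` induces an isomorphism of `G / ker ρ` with `Q`
        (∃ ρ : G →* Multiplicative UnitAddCircle,
          (∀ g : G, ρ g = Multiplicative.ofAdd (rotationNumber (g : HomeoPlusCircle))) ∧
          ∃ e : G ⧸ ρ.ker ≃* Q, ∀ g : G, e (QuotientGroup.mk g) = (j g).right) ∧
        -- `H₀` and `Q` generate their restricted wreath product, and this extends to an
        -- embedding `Φ` of the unrestricted one, whose image contains `G`
        ∃ b : restrictedWreath H₀ Q ≃* (H₀ ⊔ Q : Subgroup HomeoPlusCircle),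
          (∀ h : H₀, (b ⟨wreathBase H₀ Q h, wreathBase_mem_restrictedWreath H₀ Q h⟩ :
            HomeoPlusCircle) = h) ∧
          (∀ q : Q, (b ⟨RegularWreathProduct.inl q, inl_mem_restrictedWreath H₀ Q q⟩ :
            HomeoPlusCircle) = q) ∧
          ∃ Φ : H₀ ≀ᵣ Q →* HomeoPlusCircle, Function.Injective Φ ∧
            (∀ w : restrictedWreath H₀ Q, Φ w = b w) ∧
            ∀ g : G, Φ (j g) = g := by
  have hne := hG.nonempty_commonFixedSet
  by_cases hker : (rotationHom hne).ker = ⊥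
  · left
    intro x hx y hy
    have hinj := (MonoidHom.ker_eq_bot_iff _).1 hker
    have h : (⟨x, hx⟩ : G) * ⟨y, hy⟩ = ⟨y, hy⟩ * ⟨x, hx⟩ :=
      hinj (by rw [map_mul, map_mul, mul_comm])
    exact congrArg Subtype.val h
  · right
    obtain ⟨D⟩ := nonempty_fibreGluing hne
    have hcount := countable_quotient_ker_rotationHom hne hker
    have hfix : ∀ h ∈ D.restrictHom.range, ∀ x ∈ commonFixedSet G, h • x = x := by
      rintro _ ⟨k, rfl⟩ x hx
      by_cases h1 : D.index x = 1
      · rw [D.restrictHom_smul_of_index_eq_one k h1]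
        exact smul_eq_of_mem_ker_rotationHom hne k.2 hx
      · exact D.restrictHom_smul_of_index_ne_one k h1
    refine ⟨D.restrictHom.range, D.shift.range, fun h hh => ?_, ?_, ?_, ?_, D.embedding,
      D.embedding_injective, ⟨rotationHom hne, fun _ => rfl, D.shiftEquiv, fun g =>
        (D.embedding_right g).symm⟩, D.restrictedWreathEquiv, fun h => ?_, fun q => ?_,
      D.wreathHom, D.wreathHom_injective, fun w => rfl, D.wreathHom_embedding⟩
    · obtain ⟨p, hp⟩ := hne
      exact rotationNumber_eq_zero_iff.2 ⟨p, hfix h hh p hp⟩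
    · obtain ⟨p, hp⟩ : ∃ p : ℝ, (p : UnitAddCircle) ∈ commonFixedSet G := by
        obtain ⟨p, hp⟩ := hne
        induction p using QuotientAddGroup.induction_on with
        | H p => exact ⟨p, hp⟩
      have hle : D.restrictHom.range ≤
          MulAction.stabilizer HomeoPlusCircle (p : UnitAddCircle) := fun h hh => hfix h hh _ hp
      -- All of `H₀` fixes `p`, so cutting the circle there gives an embedding with a single factor.
      refine ⟨Unit, inferInstance,
        MonoidHom.pi fun _ => (cutAt p).comp (Subgroup.inclusion hle), fun f g h => ?_⟩
      exact Subgroup.inclusion_injective hle (cutAt_injective p (congrFun h ()))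
    -- `H₀` is a quotient of a subgroup of `G`.
    · exact (hG.of_injective (rotationHom hne).ker.subtype_injective).of_surjective
        D.restrictHom.rangeRestrict_surjective
    · have e : D.shift.range ≃* (rotationHom hne).range :=
        D.shiftEquiv.symm.trans (QuotientGroup.quotientKerEquivRange _)
      refine ⟨AddSubgroup.toSubgroup.symm (rotationHom hne).range, ?_, ⟨e.trans ?_⟩⟩
      · exact Function.Injective.countable (β := G ⧸ (rotationHom hne).ker)
          (f := fun a => (QuotientGroup.quotientKerEquivRange (rotationHom hne)).symm
            ⟨Multiplicative.ofAdd a.1, a.2⟩) fun a a' h => by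
              have h1 := MulEquiv.injective _ h
              exact Subtype.ext (congrArg (fun z : (rotationHom hne).range => Multiplicative.toAdd z.1) h1)
      · exact
          { toFun := fun a => Multiplicative.ofAdd ⟨Multiplicative.toAdd a.1, a.2⟩
            invFun := fun a => ⟨Multiplicative.ofAdd (Multiplicative.toAdd a).1,
              (Multiplicative.toAdd a).2⟩
            left_inv := fun _ => rfl
            right_inv := fun _ => rfl
            map_mul' := fun _ _ => rfl }
    · rw [D.coe_restrictedWreathEquiv, D.wreathHom_wreathBase]
    · rw [D.coe_restrictedWreathEquiv, D.wreathHom_inl]
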